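/- Let $N\in\{1,2,3,4\}$, let $\sigma_1,\sigma_2,\omega,\lambda>0$, and let $p>1$ satisfy $(N-2)(p+1)\le 2N$ (so $p>1$ is arbitrary if $N\le 2$, $p\le 5$ if $N=3$, and $p\le 3$ if $N=4$). Let $H=H^1(\mathbb{R}^N)\times H^1(\mathbb{R}^N)$ (real-valued functions) with the inner product $$\langle (u,v),(\varphi,\psi)\rangle_H=\int_{\mathbb{R}^N}\bigl(\sigma_1\nabla u\cdot\nabla\varphi+\omega u\varphi+\sigma_2\nabla v\cdot\nabla\psi+\omega v\psi\bigr)\,dx .$$ For $(u,v)\in H$ put $$I(u,v)=\frac12\int_{\mathbb{R}^N}\bigl(\sigma_1|\nabla u|^2+\sigma_2|\nabla v|^2+\omega(u^2+v^2)\bigr)dx-\frac1{p+1}\int_{\mathbb{R}^N}\bigl(|u|^{p+1}+|v|^{p+1}\bigr)dx-\frac{\lambda}{2}\int_{\mathbb{R}^N}|u|^2|v|^2\,dx ,$$ and let $f(s,t)=(|s|^{p-1}+\lambda|t|^2)s$. Then: (i) The three integrals are finite for every $(u,v)\in H$, and $I:H\to\mathbb{R}$ is continuously Fréchet differentiable.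 (ii) Every critical point $(u,v)\in H$ of $I$ is a weak solution of the system $$-\omega u+\sigma_1\Delta u+f(u,v)=0,\qquad -\omega v+\sigma_2\Delta v+f(v,u)=0\quad\text{in }\mathbb{R}^N,$$ that is, for all $\varphi,\psi\in C_c^\infty(\mathbb{R}^N)$ the integrand below is integrable and $$\int_{\mathbb{R}^N}\bigl(\sigma_1\nabla u\cdot\nabla\varphi+\omega u\varphi+\sigma_2\nabla v\cdot\nabla\psi+\omega v\psi-f(u,v)\varphi-f(v,u)\psi\bigr)\,dx=0 .$$ (iii) $I$ is bounded neither above nor below on $H$. -/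

import Mathlib

open MeasureTheory Set

noncomputable section

/-- Real-valued `L²(ℝᴺ)`. -/
abbrev L2R (N : ℕ) : Type := Lp ℝ 2 (volume : Measure (EuclideanSpace ℝ (Fin N)))

/-- `L²` vector fields on `ℝᴺ`. -/
abbrev L2Vec (N : ℕ) : Type :=
  Lp (EuclideanSpace ℝ (Fin N)) 2 (volume : Measure (EuclideanSpace ℝ (Fin N)))

/-- Test functions: `φ ∈ C_c^∞(ℝᴺ)`. -/
def IsTestFunction {N : ℕ} (φ : EuclideanSpace ℝ (Fin N) → ℝ) : Prop :=
  ContDiff ℝ ((⊤ : ℕ∞) : WithTop ℕ∞) φ ∧ HasCompactSupport φ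

/-- `g` is the weak gradient of `u`: `∫ u ∂ᵢφ = - ∫ gᵢ φ` for all `i` and all test
functions `φ`. -/
def IsWeakGradient {N : ℕ} (u : L2R N) (g : L2Vec N) : Prop :=
  ∀ φ : EuclideanSpace ℝ (Fin N) → ℝ, IsTestFunction φ → ∀ i : Fin N,
    ∫ x, u x * fderiv ℝ φ x (EuclideanSpace.single i 1) = - ∫ x, g x i * φ x

theorem IsTestFunction.memLp {N : ℕ} {φ : EuclideanSpace ℝ (Fin N) → ℝ}
    (h : IsTestFunction φ) : MemLp φ 2 volume :=
  h.1.continuous.memLp_of_hasCompactSupport h.2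

theorem IsTestFunction.memLp_fderiv {N : ℕ} {φ : EuclideanSpace ℝ (Fin N) → ℝ}
    (h : IsTestFunction φ) (e : EuclideanSpace ℝ (Fin N)) :
    MemLp (fun x => fderiv ℝ φ x e) 2 volume :=
  ((h.1.continuous_fderiv (by simp)).clm_apply continuous_const).memLp_of_hasCompactSupport
    (h.2.fderiv_apply (𝕜 := ℝ) e)

theorem L2Vec.memLp_coord {N : ℕ} (g : L2Vec N) (i : Fin N) :
    MemLp (fun x => g x i) 2 volume :=
  (EuclideanSpace.proj (𝕜 := ℝ) i).comp_memLp' (Lp.memLp g)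

theorem IsWeakGradient.add {N : ℕ} {u u' : L2R N} {g g' : L2Vec N}
    (h : IsWeakGradient u g) (h' : IsWeakGradient u' g') :
    IsWeakGradient (u + u') (g + g') := by
  intro φ hφ i
  have e1 : ∫ x, (u + u') x * fderiv ℝ φ x (EuclideanSpace.single i 1)
      = ∫ x, (u x * fderiv ℝ φ x (EuclideanSpace.single i 1)
        + u' x * fderiv ℝ φ x (EuclideanSpace.single i 1)) := by
    refine integral_congr_ae ?_
    filter_upwards [Lp.coeFn_add u u'] with x hx
    rw [hx, Pi.add_apply, add_mul]
  have e2 : ∫ x, (g + g') x i * φ x = ∫ x, (g x i * φ x + g' x i * φ x) := by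
    refine integral_congr_ae ?_
    filter_upwards [Lp.coeFn_add g g'] with x hx
    rw [hx, Pi.add_apply, PiLp.add_apply, add_mul]
  rw [e1, e2, integral_add, integral_add, h φ hφ i, h' φ hφ i, neg_add]
  · exact (L2Vec.memLp_coord g i).integrable_mul hφ.memLp
  · exact (L2Vec.memLp_coord g' i).integrable_mul hφ.memLp
  · exact (Lp.memLp u).integrable_mul (hφ.memLp_fderiv _)
  · exact (Lp.memLp u').integrable_mul (hφ.memLp_fderiv _)

theorem IsWeakGradient.smul {N : ℕ} {u : L2R N} {g : L2Vec N} (c : ℝ)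
    (h : IsWeakGradient u g) : IsWeakGradient (c • u) (c • g) := by
  intro φ hφ i
  have e1 : ∫ x, (c • u) x * fderiv ℝ φ x (EuclideanSpace.single i 1)
      = ∫ x, c * (u x * fderiv ℝ φ x (EuclideanSpace.single i 1)) := by
    refine integral_congr_ae ?_
    filter_upwards [Lp.coeFn_smul c u] with x hx
    rw [hx, Pi.smul_apply, smul_eq_mul, mul_assoc]
  have e2 : ∫ x, (c • g) x i * φ x = ∫ x, c * (g x i * φ x) := by
    refine integral_congr_ae ?_
    filter_upwards [Lp.coeFn_smul c g] with x hx
    rw [hx, Pi.smul_apply, PiLp.smul_apply, smul_eq_mul, mul_assoc]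
  rw [e1, e2, integral_const_mul, integral_const_mul, h φ hφ i, mul_neg]

theorem IsWeakGradient.zero {N : ℕ} : IsWeakGradient (0 : L2R N) (0 : L2Vec N) := by
  intro φ _ i
  have e1 : ∫ x, (0 : L2R N) x * fderiv ℝ φ x (EuclideanSpace.single i 1) = 0 := by
    rw [← integral_zero (EuclideanSpace ℝ (Fin N)) ℝ]
    refine integral_congr_ae ?_
    filter_upwards [Lp.coeFn_zero ℝ 2 (volume : Measure (EuclideanSpace ℝ (Fin N)))] with x hx
    rw [hx, Pi.zero_apply, zero_mul]
  have e2 : ∫ x, (0 : L2Vec N) x i * φ x = 0 := by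
    rw [← integral_zero (EuclideanSpace ℝ (Fin N)) ℝ]
    refine integral_congr_ae ?_
    filter_upwards [Lp.coeFn_zero (EuclideanSpace ℝ (Fin N)) 2
      (volume : Measure (EuclideanSpace ℝ (Fin N)))] with x hx
    rw [hx, Pi.zero_apply, PiLp.zero_apply, zero_mul]
  rw [e1, e2, neg_zero]

/-- The weak gradient is unique. -/
theorem IsWeakGradient.unique {N : ℕ} {u : L2R N} {g g' : L2Vec N}
    (h : IsWeakGradient u g) (h' : IsWeakGradient u g') : g = g' := by
  have key : ∀ i : Fin N, ∀ᵐ x, g x i - g' x i = 0 := by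
    intro i
    refine ae_eq_zero_of_integral_contDiff_smul_eq_zero
      (((L2Vec.memLp_coord g i).sub (L2Vec.memLp_coord g' i)).locallyIntegrable
        (by norm_num)) ?_
    intro φ hφ hφc
    have hφ' : IsTestFunction φ := ⟨hφ, hφc⟩
    have e : ∀ x, φ x • ((fun x => g x i) - fun x => g' x i) x
        = g x i * φ x - g' x i * φ x := by
      intro x; simp only [Pi.sub_apply, smul_eq_mul]; ring
    have e0 := (h φ hφ' i).symm.trans (h' φ hφ' i)
    refine (integral_congr_ae (Filter.Eventually.of_forall e)).trans ?_
    have j1 := (L2Vec.memLp_coord g i).integrable_mul hφ'.memLp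
    have j2 := (L2Vec.memLp_coord g' i).integrable_mul hφ'.memLp
    refine (integral_sub j1 j2).trans ?_
    simp only [Pi.mul_apply]
    linarith
  refine Lp.ext ?_
  filter_upwards [ae_all_iff.2 key] with x hx
  ext i
  exact sub_eq_zero.1 (hx i)

/-- The Sobolev space `H¹(ℝᴺ)`: real `L²` functions with a weak gradient in `L²`. -/
def H1 (N : ℕ) : Submodule ℝ (L2R N) where
  carrier := {u | ∃ g : L2Vec N, IsWeakGradient u g}
  add_mem' := by
    rintro u u' ⟨g, hg⟩ ⟨g', hg'⟩
    exact ⟨g + g', hg.add hg'⟩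
  zero_mem' := ⟨0, IsWeakGradient.zero⟩
  smul_mem' := by
    rintro c u ⟨g, hg⟩
    exact ⟨c • g, hg.smul c⟩

/-- The weak gradient `∇u ∈ L²` of `u ∈ H¹(ℝᴺ)`. -/
def weakGrad {N : ℕ} (u : H1 N) : L2Vec N := Classical.choose u.2

theorem weakGrad_spec {N : ℕ} (u : H1 N) : IsWeakGradient (u : L2R N) (weakGrad u) :=
  Classical.choose_spec u.2

theorem weakGrad_add {N : ℕ} (u v : H1 N) : weakGrad (u + v) = weakGrad u + weakGrad v :=
  (weakGrad_spec (u + v)).unique ((weakGrad_spec u).add (weakGrad_spec v))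

theorem weakGrad_smul {N : ℕ} (c : ℝ) (u : H1 N) : weakGrad (c • u) = c • weakGrad u :=
  (weakGrad_spec (c • u)).unique ((weakGrad_spec u).smul c)

/-- The space `H = H¹(ℝᴺ) × H¹(ℝᴺ)` for coefficients `σ₁, σ₂, ω > 0`, which enter
through its inner product (below). It is not reducible to the product, so that it does not
inherit the sup norm. -/
def PairSpace (N : ℕ) {σ₁ σ₂ ω : ℝ} (_ : 0 < σ₁) (_ : 0 < σ₂) (_ : 0 < ω) : Type :=
  H1 N × H1 N

section PairSpace

variable {N : ℕ} {σ₁ σ₂ ω : ℝ} {hσ₁ : 0 < σ₁} {hσ₂ : 0 < σ₂} {hω : 0 < ω}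

instance : AddCommGroup (PairSpace N hσ₁ hσ₂ hω) :=
  inferInstanceAs (AddCommGroup (H1 N × H1 N))

instance : Module ℝ (PairSpace N hσ₁ hσ₂ hω) :=
  inferInstanceAs (Module ℝ (H1 N × H1 N))

/-- The first component `u` of `w = (u, v)`. -/
def PairSpace.u (w : PairSpace N hσ₁ hσ₂ hω) : H1 N := Prod.fst w

/-- The second component `v` of `w = (u, v)`. -/
def PairSpace.v (w : PairSpace N hσ₁ hσ₂ hω) : H1 N := Prod.snd w

/-- The inner product of `H`,
`∫ (σ₁ ∇u·∇φ + ω u φ + σ₂ ∇v·∇ψ + ω v ψ)`. -/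
def pairInner (w z : PairSpace N hσ₁ hσ₂ hω) : ℝ :=
  ∫ x, (σ₁ * inner ℝ (weakGrad w.u x) (weakGrad z.u x)
    + ω * ((w.u : L2R N) x * (z.u : L2R N) x)
    + σ₂ * inner ℝ (weakGrad w.v x) (weakGrad z.v x)
    + ω * ((w.v : L2R N) x * (z.v : L2R N) x))

theorem pairInner_eq (w z : PairSpace N hσ₁ hσ₂ hω) :
    pairInner w z =
      σ₁ * inner ℝ (weakGrad w.u) (weakGrad z.u) + ω * inner ℝ (w.u : L2R N) (z.u : L2R N)
      + σ₂ * inner ℝ (weakGrad w.v) (weakGrad z.v)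
      + ω * inner ℝ (w.v : L2R N) (z.v : L2R N) := by
  have i1 := (L2.integrable_inner (𝕜 := ℝ) (weakGrad w.u) (weakGrad z.u)).const_mul σ₁
  have i3 := (L2.integrable_inner (𝕜 := ℝ) (weakGrad w.v) (weakGrad z.v)).const_mul σ₂
  have i2 := ((Lp.memLp (w.u : L2R N)).integrable_mul (Lp.memLp (z.u : L2R N))).const_mul ω
  have i4 := ((Lp.memLp (w.v : L2R N)).integrable_mul (Lp.memLp (z.v : L2R N))).const_mul ω
  simp only [Pi.mul_apply] at i2 i4
  have e : ∀ a b : L2R N, inner ℝ a b = ∫ x, a x * b x := by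
    intro a b
    rw [L2.inner_def]
    refine integral_congr_ae (Filter.Eventually.of_forall fun x => ?_)
    simp [mul_comm]
  have s1 := integral_add ((i1.add i2).add i3) i4
  have s2 := integral_add (i1.add i2) i3
  have s3 := integral_add i1 i2
  refine s1.trans ((congrArg₂ (· + ·) (s2.trans (congrArg₂ (· + ·) s3 rfl)) rfl).trans ?_)
  simp only [integral_const_mul]
  rw [e, e, L2.inner_def, L2.inner_def]

/-- `pairInner` is an inner product on `H`. -/
@[reducible] def pairCore : InnerProductSpace.Core ℝ (PairSpace N hσ₁ hσ₂ hω) where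
  inner := pairInner
  conj_inner_symm w z := by
    simp only [pairInner_eq, conj_trivial]
    rw [real_inner_comm (weakGrad w.u), real_inner_comm (weakGrad w.v),
      real_inner_comm (w.u : L2R N), real_inner_comm (w.v : L2R N)]
  re_inner_nonneg w := by
    simp only [pairInner_eq, RCLike.re_to_real, real_inner_self_eq_norm_sq]
    positivity
  add_left w z y := by
    have h1 : (w + z).u = w.u + z.u := rfl
    have h2 : (w + z).v = w.v + z.v := rfl
    simp only [pairInner_eq, h1, h2, weakGrad_add, Submodule.coe_add, inner_add_left]
    ring
  smul_left w z r := by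
    have h1 : (r • w).u = r • w.u := rfl
    have h2 : (r • w).v = r • w.v := rfl
    simp only [pairInner_eq, h1, h2, weakGrad_smul, Submodule.coe_smul, real_inner_smul_left,
      conj_trivial]
    ring
  definite w hw := by
    simp only [pairInner_eq, real_inner_self_eq_norm_sq] at hw
    have a1 : 0 ≤ σ₁ * ‖weakGrad w.u‖ ^ 2 := by positivity
    have a2 : 0 ≤ σ₂ * ‖weakGrad w.v‖ ^ 2 := by positivity
    have a3 : 0 ≤ ω * ‖(w.u : L2R N)‖ ^ 2 := by positivity
    have a4 : 0 ≤ ω * ‖(w.v : L2R N)‖ ^ 2 := by positivity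
    have b3 : ω * ‖(w.u : L2R N)‖ ^ 2 = 0 := by linarith
    have b4 : ω * ‖(w.v : L2R N)‖ ^ 2 = 0 := by linarith
    have c3 : w.u = 0 := by simpa [hω.ne'] using b3
    have c4 : w.v = 0 := by simpa [hω.ne'] using b4
    exact Prod.ext c3 c4

instance : NormedAddCommGroup (PairSpace N hσ₁ hσ₂ hω) :=
  pairCore.toNormedAddCommGroup

instance : InnerProductSpace ℝ (PairSpace N hσ₁ hσ₂ hω) :=
  InnerProductSpace.ofCore pairCore.toCore

theorem inner_eq_pairInner (w z : PairSpace N hσ₁ hσ₂ hω) : inner ℝ w z = pairInner w z := rfl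

end PairSpace

/-- `𝓛(u,v) = ∫ (σ₁ |∇u|² + σ₂ |∇v|² + ω (u² + v²))`. -/
def functionalL {N : ℕ} (σ₁ σ₂ ω : ℝ) (u v : H1 N) : ℝ :=
  ∫ x, (σ₁ * ‖weakGrad u x‖ ^ 2 + σ₂ * ‖weakGrad v x‖ ^ 2
    + ω * ((u : L2R N) x ^ 2 + (v : L2R N) x ^ 2))

/-- `𝓜_p(u,v) = ∫ (|u|^{p+1} + |v|^{p+1})`. -/
def functionalM {N : ℕ} (p : ℝ) (u v : H1 N) : ℝ :=
  ∫ x, (|(u : L2R N) x| ^ (p + 1) + |(v : L2R N) x| ^ (p + 1))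

/-- `𝓝_λ(u,v) = λ ∫ |u|² |v|²`. -/
def functionalN {N : ℕ} (lam : ℝ) (u v : H1 N) : ℝ :=
  lam * ∫ x, |(u : L2R N) x| ^ 2 * |(v : L2R N) x| ^ 2

/-- The energy functional `I = 𝓛 / 2 - 𝓜_p / (p+1) - 𝓝_λ / 2` on `H`. -/
def energy {N : ℕ} (p lam : ℝ) {σ₁ σ₂ ω : ℝ} {hσ₁ : 0 < σ₁} {hσ₂ : 0 < σ₂} {hω : 0 < ω}
    (w : PairSpace N hσ₁ hσ₂ hω) : ℝ :=
  1 / 2 * functionalL σ₁ σ₂ ω w.u w.v - 1 / (p + 1) * functionalM p w.u w.v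
    - 1 / 2 * functionalN lam w.u w.v

/-- `f(s,t) = (|s|^{p-1} + λ |t|²) s`. -/
def nonlin (p lam s t : ℝ) : ℝ := (|s| ^ (p - 1) + lam * |t| ^ 2) * s

/-- `(u,v) ∈ H` is a weak solution of
`-ω u + σ₁ Δu + f(u,v) = 0`, `-ω v + σ₂ Δv + f(v,u) = 0`: for all test functions `φ, ψ` the
integrand of the weak formulation is integrable, and its integral vanishes. -/
def IsWeakSolution {N : ℕ} (p lam σ₁ σ₂ ω : ℝ) (u v : H1 N) : Prop :=
  ∀ φ ψ : EuclideanSpace ℝ (Fin N) → ℝ, IsTestFunction φ → IsTestFunction ψ →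
    let F : EuclideanSpace ℝ (Fin N) → ℝ := fun x =>
      σ₁ * inner ℝ (weakGrad u x) (gradient φ x) + ω * ((u : L2R N) x * φ x)
      + σ₂ * inner ℝ (weakGrad v x) (gradient ψ x) + ω * ((v : L2R N) x * ψ x)
      - nonlin p lam ((u : L2R N) x) ((v : L2R N) x) * φ x
      - nonlin p lam ((v : L2R N) x) ((u : L2R N) x) * ψ x
    Integrable F ∧ ∫ x, F x = 0

end

noncomputable section

/-! By the Sobolev embedding, `H` maps continuously into `L ^ q` in each component whenever `2 ≤ q`
and `(N - 2) q ≤ 2 N`. This covers `q = p + 1` by assumption and `q = 4` because `N ≤ 4`. Hence `𝓛`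
is the squared Hilbert norm, `𝓜_p` is the functional `∫ |f| ^ (p + 1)` composed with the embeddings
into `L ^ (p + 1)`, and `𝓝_λ` is `λ ‖u v‖²`, where multiplication is a bounded bilinear map `L⁴ × L⁴
→ L²`. Each piece is `C¹`, and the chain rule gives the derivative as the weak formulation. Test
functions lie in `H¹` with their classical gradient, so a critical point is a weak solution.

The `C¹` property on `L ^ (p + 1)` (`exists_hasFDerivAt_integral_abs_rpow`) follows from pointwise
first-order estimates and a three-factor Hölder inequality. The embedding is proved as an a priori
bound for `C¹` functions of compact support (`hasSobolevBound`), then carried to `H¹` by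
mollification, cut-off and Fatou (`HasSobolevBound.lintegral_le_of_isWeakGradient`).

For unboundedness take `v = 0`. Along a ray the power `p + 1 > 2` beats the quadratic part, so `I →
-∞`. A plateau of small fixed height and growing radius keeps the power term below a fraction of `ω
∫ u²`, which itself tends to infinity, so `I` is not bounded above. -/

/-! ### Pointwise estimates for powers. -/

/-- Bernoulli's inequality at `b / a - 1`, multiplied by `a ^ p`: the convex function lies above its
tangent at `a`. -/
theorem Real.rpow_sub_rpow_le_mul_sub {p a b : ℝ} (hp : 1 ≤ p) (hb : 0 ≤ b) (hab : b ≤ a) :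
    a ^ p - b ^ p ≤ p * a ^ (p - 1) * (a - b) := by
  rcases (hb.trans hab).eq_or_lt with h0 | h0
  · have : b = 0 := le_antisymm (hab.trans h0.ge) hb
    subst this; subst h0; simp
  have h := one_add_mul_self_le_rpow_one_add (s := b / a - 1) (p := p)
    (by linarith [div_nonneg hb h0.le]) hp
  have e : (1 + (b / a - 1)) ^ p = b ^ p / a ^ p := by
    rw [← Real.div_rpow hb h0.le]; ring_nf
  have ea : a ^ p = a ^ (p - 1) * a := by
    rw [← Real.rpow_add_one h0.ne']; ring_nf
  rw [e, le_div_iff₀ (Real.rpow_pos_of_pos h0 p)] at h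
  have e2 : (1 + p * (b / a - 1)) * a ^ p = a ^ p + p * a ^ (p - 1) * (b - a) := by
    rw [ea]; field_simp
  linarith

theorem abs_rpow_mul_self_of_nonneg {p a : ℝ} (hp : 1 < p) (ha : 0 ≤ a) :
    |a| ^ (p - 1) * a = a ^ p := by
  rw [abs_of_nonneg ha]
  rcases ha.eq_or_lt with h | h
  · rw [← h, Real.zero_rpow (by linarith : p ≠ 0), mul_zero]
  · rw [← Real.rpow_add_one h.ne']; ring_nf

/-- For equal signs, oddness reduces to the tangent bound. For opposite signs `|a - b| = |a| + |b|`,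
so the triangle inequality suffices, even with constant `1` in place of `p`. -/
theorem abs_rpow_mul_self_sub_le_of_le {p a b : ℝ} (hp : 1 < p) (hab : b ≤ a) :
    |(|a| ^ (p - 1) * a - |b| ^ (p - 1) * b)| ≤ p * (|a| + |b|) ^ (p - 1) * |a - b| := by
  have pos {a b : ℝ} (hb : 0 ≤ b) (hab : b ≤ a) :
      |(|a| ^ (p - 1) * a - |b| ^ (p - 1) * b)| ≤ p * (|a| + |b|) ^ (p - 1) * |a - b| := by
    rw [abs_rpow_mul_self_of_nonneg hp hb, abs_rpow_mul_self_of_nonneg hp (hb.trans hab),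
      abs_of_nonneg (sub_nonneg.2 (Real.rpow_le_rpow hb hab (by linarith))),
      abs_of_nonneg (sub_nonneg.2 hab)]
    refine (Real.rpow_sub_rpow_le_mul_sub hp.le hb hab).trans ?_
    have : a ^ (p - 1) ≤ (|a| + |b|) ^ (p - 1) :=
      Real.rpow_le_rpow (hb.trans hab) (by linarith [le_abs_self a, abs_nonneg b]) (by linarith)
    have := sub_nonneg.2 hab
    gcongr
  rcases le_total 0 b with hb | hb
  · exact pos hb hab
  rcases le_total a 0 with ha | ha
  · have := pos (neg_nonneg.2 ha) (neg_le_neg hab)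
    simp only [abs_neg, mul_neg, neg_sub_neg] at this
    rwa [add_comm |a|]
  · have h1 : |a - b| = |a| + |b| := by
      rw [abs_of_nonneg (by linarith), abs_of_nonneg ha, abs_of_nonpos hb]; ring
    have ha' : |a| ^ (p - 1) ≤ (|a| + |b|) ^ (p - 1) :=
      Real.rpow_le_rpow (abs_nonneg a) (by linarith [abs_nonneg b]) (by linarith)
    have hb' : |b| ^ (p - 1) ≤ (|a| + |b|) ^ (p - 1) :=
      Real.rpow_le_rpow (abs_nonneg b) (by linarith [abs_nonneg a]) (by linarith)
    have hA : 0 ≤ (|a| + |b|) ^ (p - 1) := by positivity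
    calc |(|a| ^ (p - 1) * a - |b| ^ (p - 1) * b)|
        ≤ |(|a| ^ (p - 1) * a)| + |(|b| ^ (p - 1) * b)| := abs_sub _ _
      _ = |a| ^ (p - 1) * |a| + |b| ^ (p - 1) * |b| := by
          rw [abs_mul, abs_mul, abs_of_nonneg (by positivity : 0 ≤ |a| ^ (p - 1)),
            abs_of_nonneg (by positivity : 0 ≤ |b| ^ (p - 1))]
      _ ≤ (|a| + |b|) ^ (p - 1) * |a| + (|a| + |b|) ^ (p - 1) * |b| := by gcongr
      _ = 1 * (|a| + |b|) ^ (p - 1) * |a - b| := by rw [h1]; ring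
      _ ≤ _ := by gcongr

theorem abs_rpow_mul_self_sub_le {p : ℝ} (hp : 1 < p) (a b : ℝ) :
    |(|a| ^ (p - 1) * a - |b| ^ (p - 1) * b)| ≤ p * (|a| + |b|) ^ (p - 1) * |a - b| := by
  rcases le_total b a with h | h
  · exact abs_rpow_mul_self_sub_le_of_le hp h
  · have := abs_rpow_mul_self_sub_le_of_le hp h
    rwa [abs_sub_comm, add_comm |b|, abs_sub_comm b] at this

/-- First-order Taylor estimate for `t ↦ |t| ^ (p + 1)`. -/
theorem abs_rpow_add_sub_sub_le {p : ℝ} (hp : 1 < p) (a h : ℝ) :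
    |(|a + h| ^ (p + 1) - |a| ^ (p + 1) - (p + 1) * (|a| ^ (p - 1) * a * h))| ≤
      (p + 1) * p * ((2 * |a| + |h|) ^ (p - 1) * |h| * |h|) := by
  -- `F 1 - F 0` is the Taylor remainder, so the mean value inequality on `[0, 1]` needs only a
  -- bound on `F'`, a difference of values of `|t| ^ (p - 1) * t`.
  let F : ℝ → ℝ := fun s => |a + s * h| ^ (p + 1) - s * ((p + 1) * (|a| ^ (p - 1) * a * h))
  have hF (s : ℝ) : HasDerivAt F
      ((p + 1) * h * (|a + s * h| ^ (p - 1) * (a + s * h) - |a| ^ (p - 1) * a)) s := by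
    have h1 : HasDerivAt (fun s : ℝ => a + s * h) h s := by
      simpa using ((hasDerivAt_id s).mul_const h).const_add a
    have h2 := (hasDerivAt_abs_rpow (p := p + 1) (a + s * h) (by linarith)).comp s h1
    have h3 := h2.sub ((hasDerivAt_id s).mul_const ((p + 1) * (|a| ^ (p - 1) * a * h)))
    refine h3.congr_deriv ?_
    rw [show p + 1 - 2 = p - 1 by ring]
    ring
  have hb : ∀ s ∈ Icc (0 : ℝ) 1,
      ‖(p + 1) * h * (|a + s * h| ^ (p - 1) * (a + s * h) - |a| ^ (p - 1) * a)‖ ≤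
        (p + 1) * p * ((2 * |a| + |h|) ^ (p - 1) * |h| * |h|) := by
    intro s hs
    have h0 := abs_rpow_mul_self_sub_le hp (a + s * h) a
    have hsh : |s * h| ≤ |h| := by
      rw [abs_mul, abs_of_nonneg hs.1]
      exact mul_le_of_le_one_left (abs_nonneg h) hs.2
    have h1 : (|a + s * h| + |a|) ^ (p - 1) ≤ (2 * |a| + |h|) ^ (p - 1) :=
      Real.rpow_le_rpow (by positivity) (by linarith [abs_add_le a (s * h)]) (by linarith)
    rw [Real.norm_eq_abs, abs_mul, abs_mul, abs_of_pos (by linarith : 0 < p + 1)]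
    rw [add_sub_cancel_left] at h0
    calc (p + 1) * |h| * |(|a + s * h| ^ (p - 1) * (a + s * h) - |a| ^ (p - 1) * a)|
        ≤ (p + 1) * |h| * (p * (|a + s * h| + |a|) ^ (p - 1) * |s * h|) := by gcongr
      _ ≤ (p + 1) * |h| * (p * (2 * |a| + |h|) ^ (p - 1) * |h|) := by gcongr
      _ = _ := by ring
  have := (convex_Icc (0 : ℝ) 1).norm_image_sub_le_of_norm_hasDerivWithin_le
    (fun s _ => (hF s).hasDerivWithinAt) hb (left_mem_Icc.2 zero_le_one)
    (right_mem_Icc.2 zero_le_one)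
  simp only [F, one_mul, zero_mul, add_zero, sub_zero, Real.norm_eq_abs, abs_one, mul_one] at this
  convert this using 2
  ring

/-! ### Differentiability of `∫ |f| ^ (p + 1)` on `L ^ (p + 1)`. -/

section Hoelder

variable {α : Type*} [MeasurableSpace α] {μ : Measure α}

/-- Hölder's inequality for `|A| ^ (p - 1) * |h| * |k|` with all three functions in
`L ^ (p + 1)`. -/
theorem lintegral_rpow_mul_mul_le {p : ℝ} (hp : 1 < p) {A h k : α → ℝ}
    (hA : AEMeasurable A μ) (hh : AEMeasurable h μ) (hk : AEMeasurable k μ) :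
    ∫⁻ x, ‖A x‖ₑ ^ (p - 1) * ‖h x‖ₑ * ‖k x‖ₑ ∂μ ≤
      eLpNorm A (ENNReal.ofReal (p + 1)) μ ^ (p - 1) * eLpNorm h (ENNReal.ofReal (p + 1)) μ
        * eLpNorm k (ENNReal.ofReal (p + 1)) μ := by
  have hq : 0 < p + 1 := by linarith
  -- The weights `(p - 1) / (p + 1)`, `1 / (p + 1)`, `1 / (p + 1)` sum to one; raising the functions
  -- to the power `p + 1` first makes the weights restore the wanted exponents.
  have key := ENNReal.lintegral_prod_norm_pow_le (μ := μ) (Finset.univ : Finset (Fin 3))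
    (f := ![fun x => ‖A x‖ₑ ^ (p + 1), fun x => ‖h x‖ₑ ^ (p + 1), fun x => ‖k x‖ₑ ^ (p + 1)])
    (p := ![(p - 1) / (p + 1), 1 / (p + 1), 1 / (p + 1)])
    (by
      intro i _
      fin_cases i
      · exact hA.enorm.pow_const _
      · exact hh.enorm.pow_const _
      · exact hk.enorm.pow_const _)
    (by
      simp [Fin.sum_univ_three]
      field_simp
      ring)
    (by
      intro i _
      fin_cases i
      · exact div_nonneg (by linarith) hq.le
      · exact div_nonneg zero_le_one hq.le
      · exact div_nonneg zero_le_one hq.le)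
  simp only [Fin.prod_univ_three, Matrix.cons_val_zero, Matrix.cons_val_one, Matrix.cons_val,
    ← ENNReal.rpow_mul] at key
  have e1 : (p + 1) * ((p - 1) / (p + 1)) = p - 1 := by field_simp
  have e2 : (p + 1) * (1 / (p + 1)) = 1 := by field_simp
  simp only [e1, e2, ENNReal.rpow_one] at key
  refine key.trans (le_of_eq ?_)
  have hne : ENNReal.ofReal (p + 1) ≠ 0 := by simpa using hq
  simp only [eLpNorm_eq_lintegral_rpow_enorm_toReal hne ENNReal.ofReal_ne_top,
    ENNReal.toReal_ofReal hq.le, ← ENNReal.rpow_mul]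
  congr 3
  ring

theorem integrable_rpow_mul_mul {p : ℝ} (hp : 1 < p) {A h k : α → ℝ}
    (hA : MemLp A (ENNReal.ofReal (p + 1)) μ) (hh : MemLp h (ENNReal.ofReal (p + 1)) μ)
    (hk : MemLp k (ENNReal.ofReal (p + 1)) μ) :
    Integrable (fun x => |A x| ^ (p - 1) * h x * k x) μ := by
  refine ⟨?_, ?_⟩
  · exact (((hA.1.aemeasurable.abs.pow_const _).mul hh.1.aemeasurable).mul
      hk.1.aemeasurable).aestronglyMeasurable
  · rw [HasFiniteIntegral]
    have e (x : α) : ‖|A x| ^ (p - 1) * h x * k x‖ₑ = ‖A x‖ₑ ^ (p - 1) * ‖h x‖ₑ * ‖k x‖ₑ := by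
      rw [enorm_mul, enorm_mul, Real.enorm_rpow_of_nonneg (abs_nonneg _) (by linarith),
        Real.enorm_abs]
    simp only [e]
    refine (lintegral_rpow_mul_mul_le hp hA.1.aemeasurable hh.1.aemeasurable
      hk.1.aemeasurable).trans_lt ?_
    refine ENNReal.mul_lt_top (ENNReal.mul_lt_top ?_ hh.2) hk.2
    exact ENNReal.rpow_lt_top_of_nonneg (by linarith) hA.2.ne

theorem integral_rpow_mul_mul_le {p : ℝ} (hp : 1 < p) {A h k : α → ℝ}
    (hA : MemLp A (ENNReal.ofReal (p + 1)) μ) (hh : MemLp h (ENNReal.ofReal (p + 1)) μ)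
    (hk : MemLp k (ENNReal.ofReal (p + 1)) μ) :
    ∫ x, |A x| ^ (p - 1) * |h x| * |k x| ∂μ ≤
      (eLpNorm A (ENNReal.ofReal (p + 1)) μ).toReal ^ (p - 1)
        * (eLpNorm h (ENNReal.ofReal (p + 1)) μ).toReal
        * (eLpNorm k (ENNReal.ofReal (p + 1)) μ).toReal := by
  rw [integral_eq_lintegral_of_nonneg_ae (Filter.Eventually.of_forall fun x => by positivity)
    (by simpa using (integrable_rpow_mul_mul hp hA hh.abs hk.abs).1)]
  rw [ENNReal.toReal_rpow, ← ENNReal.toReal_mul, ← ENNReal.toReal_mul]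
  refine ENNReal.toReal_mono ?_ ?_
  · refine ENNReal.mul_ne_top (ENNReal.mul_ne_top ?_ hh.2.ne) hk.2.ne
    exact ENNReal.rpow_ne_top_of_nonneg (by linarith) hA.2.ne
  · refine le_trans (le_of_eq ?_) (lintegral_rpow_mul_mul_le hp hA.1.aemeasurable
      hh.1.aemeasurable hk.1.aemeasurable)
    refine lintegral_congr fun x => ?_
    rw [← Real.enorm_eq_ofReal (by positivity), enorm_mul, enorm_mul,
      Real.enorm_rpow_of_nonneg (abs_nonneg _) (by linarith), Real.enorm_abs, Real.enorm_abs, Real.enorm_abs]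

theorem MemLp.integrable_abs_rpow {p : ℝ} (hp : 1 < p) {f : α → ℝ}
    (hf : MemLp f (ENNReal.ofReal (p + 1)) μ) : Integrable (fun x => |f x| ^ (p + 1)) μ := by
  have h := hf.integrable_norm_rpow (by simp; linarith) ENNReal.ofReal_ne_top
  rwa [ENNReal.toReal_ofReal (by linarith)] at h

/-- The functional `f ↦ ∫ |f| ^ (p + 1)` on `L ^ (p + 1)` is continuously differentiable. -/
theorem exists_hasFDerivAt_integral_abs_rpow {p : ℝ} (hp : 1 < p)
    [Fact (1 ≤ ENNReal.ofReal (p + 1))] :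
    ∃ D : Lp ℝ (ENNReal.ofReal (p + 1)) μ → (Lp ℝ (ENNReal.ofReal (p + 1)) μ →L[ℝ] ℝ),
      Continuous D ∧
      (∀ f, HasFDerivAt (fun g : Lp ℝ (ENNReal.ofReal (p + 1)) μ => ∫ x, |g x| ^ (p + 1) ∂μ)
        (D f) f) ∧
      ∀ f h, D f h = (p + 1) * ∫ x, |f x| ^ (p - 1) * f x * h x ∂μ := by
  have hint (f h : Lp ℝ (ENNReal.ofReal (p + 1)) μ) :
      Integrable (fun x => |f x| ^ (p - 1) * f x * h x) μ :=
    integrable_rpow_mul_mul hp (Lp.memLp f) (Lp.memLp f) (Lp.memLp h)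
  have habs (f : Lp ℝ (ENNReal.ofReal (p + 1)) μ) :
      (eLpNorm f (ENNReal.ofReal (p + 1)) μ).toReal = ‖f‖ := rfl
  let D : Lp ℝ (ENNReal.ofReal (p + 1)) μ → (Lp ℝ (ENNReal.ofReal (p + 1)) μ →L[ℝ] ℝ) :=
    fun f => LinearMap.mkContinuous
      { toFun := fun h => (p + 1) * ∫ x, |f x| ^ (p - 1) * f x * h x ∂μ
        map_add' := by
          intro h k
          rw [← mul_add, ← integral_add (hint f h) (hint f k)]
          congr 1
          refine integral_congr_ae ?_
          filter_upwards [Lp.coeFn_add h k] with x hx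
          rw [hx, Pi.add_apply, mul_add]
        map_smul' := by
          intro c h
          rw [RingHom.id_apply, smul_eq_mul, mul_left_comm, ← integral_const_mul c]
          congr 1
          refine integral_congr_ae ?_
          filter_upwards [Lp.coeFn_smul c h] with x hx
          rw [hx, Pi.smul_apply, smul_eq_mul]
          ring }
      ((p + 1) * (‖f‖ ^ (p - 1) * ‖f‖))
      (by
        intro h
        simp only [LinearMap.coe_mk, AddHom.coe_mk]
        rw [norm_mul, Real.norm_of_nonneg (by linarith : 0 ≤ p + 1), mul_assoc]
        refine mul_le_mul_of_nonneg_left ?_ (by linarith)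
        refine (norm_integral_le_integral_norm _).trans ?_
        refine le_trans (le_of_eq ?_)
          (integral_rpow_mul_mul_le hp (Lp.memLp f) (Lp.memLp f) (Lp.memLp h))
        refine integral_congr_ae (Filter.Eventually.of_forall fun x => ?_)
        simp only [norm_mul, Real.norm_eq_abs]
        rw [abs_of_nonneg (by positivity : 0 ≤ |f x| ^ (p - 1))])
  have hD (f h) : D f h = (p + 1) * ∫ x, |f x| ^ (p - 1) * f x * h x ∂μ := rfl
  have hsum (f g : Lp ℝ (ENNReal.ofReal (p + 1)) μ) :
      (eLpNorm (fun x => |f x| + |g x|) (ENNReal.ofReal (p + 1)) μ).toReal ≤ ‖f‖ + ‖g‖ := by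
    rw [← habs f, ← habs g, ← ENNReal.toReal_add (Lp.memLp f).2.ne (Lp.memLp g).2.ne]
    refine ENNReal.toReal_mono (ENNReal.add_ne_top.2 ⟨(Lp.memLp f).2.ne, (Lp.memLp g).2.ne⟩) ?_
    refine (eLpNorm_add_le (Lp.memLp f).abs.1 (Lp.memLp g).abs.1 Fact.out).trans ?_
    exact add_le_add (eLpNorm_norm (f := f)).le (eLpNorm_norm (f := g)).le
  -- `D` is locally Lipschitz: Hölder with `A = |f| + |g|` applied to the pointwise difference
  -- estimate.
  have hsub (f g : Lp ℝ (ENNReal.ofReal (p + 1)) μ) :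
      ‖D f - D g‖ ≤ (p + 1) * p * (‖f‖ + ‖g‖) ^ (p - 1) * ‖f - g‖ := by
    refine ContinuousLinearMap.opNorm_le_bound _ (by positivity) fun h => ?_
    rw [sub_apply, hD, hD, ← mul_sub, ← integral_sub (hint f h) (hint g h),
      norm_mul, Real.norm_of_nonneg (by linarith : 0 ≤ p + 1), mul_assoc (p + 1),
      mul_assoc (p + 1), mul_assoc (p + 1)]
    refine mul_le_mul_of_nonneg_left ?_ (by linarith)
    have hA : MemLp (fun x => |f x| + |g x|) (ENNReal.ofReal (p + 1)) μ :=
      (Lp.memLp f).abs.add (Lp.memLp g).abs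
    have h1 := integral_rpow_mul_mul_le hp hA (Lp.memLp (f - g)) (Lp.memLp h)
    have h2 := (integrable_rpow_mul_mul hp hA (Lp.memLp (f - g)).abs (Lp.memLp h).abs).const_mul p
    calc ‖∫ x, (|f x| ^ (p - 1) * f x * h x - |g x| ^ (p - 1) * g x * h x) ∂μ‖
        ≤ ∫ x, p * (|(|f x| + |g x|)| ^ (p - 1) * |(f - g) x| * |h x|) ∂μ := by
          refine norm_integral_le_of_norm_le h2 ?_
          filter_upwards [Lp.coeFn_sub f g] with x hx
          rw [hx, Pi.sub_apply, ← sub_mul, norm_mul, Real.norm_eq_abs, Real.norm_eq_abs,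
            abs_of_nonneg (by positivity : 0 ≤ |f x| + |g x|), ← mul_assoc, ← mul_assoc]
          gcongr
          exact abs_rpow_mul_self_sub_le hp _ _
      _ ≤ p * ((‖f‖ + ‖g‖) ^ (p - 1) * ‖f - g‖ * ‖h‖) := by
          rw [integral_const_mul]
          have := hsum f g
          refine mul_le_mul_of_nonneg_left (h1.trans ?_) (by linarith)
          rw [habs, habs]
          have : (eLpNorm (fun x => |f x| + |g x|) (ENNReal.ofReal (p + 1)) μ).toReal ^ (p - 1)
            ≤ (‖f‖ + ‖g‖) ^ (p - 1) :=
            Real.rpow_le_rpow ENNReal.toReal_nonneg this (by linarith)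
          gcongr
      _ = p * (‖f‖ + ‖g‖) ^ (p - 1) * ‖f - g‖ * ‖h‖ := by ring
  refine ⟨D, ?_, ?_, hD⟩
  · refine continuous_iff_continuousAt.2 fun f => ?_
    rw [ContinuousAt, tendsto_iff_norm_sub_tendsto_zero]
    have hc : Filter.Tendsto (fun g => (p + 1) * p * (‖g‖ + ‖f‖) ^ (p - 1) * ‖g - f‖)
        (nhds f) (nhds 0) := by
      have : Continuous fun g : Lp ℝ (ENNReal.ofReal (p + 1)) μ =>
          (p + 1) * p * (‖g‖ + ‖f‖) ^ (p - 1) * ‖g - f‖ := by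
        refine Continuous.mul (continuous_const.mul ?_) (by fun_prop)
        exact Continuous.rpow_const (by fun_prop) fun _ => Or.inr (by linarith)
      simpa using this.tendsto f
    exact squeeze_zero (fun _ => norm_nonneg _) (fun g => hsub g f) hc
  · intro f
    -- The remainder is quadratic in `‖h‖` for bounded `h`; here Hölder uses `A = |2 f| + |h|`, the
    -- base in the pointwise Taylor estimate.
    have hrem (h : Lp ℝ (ENNReal.ofReal (p + 1)) μ) :
        ‖(∫ x, |(f + h) x| ^ (p + 1) ∂μ) - (∫ x, |f x| ^ (p + 1) ∂μ) - D f h‖ ≤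
          (p + 1) * p * (2 * ‖f‖ + ‖h‖) ^ (p - 1) * ‖h‖ * ‖h‖ := by
      have hA : MemLp (fun x => |((2 : ℝ) • f) x| + |h x|) (ENNReal.ofReal (p + 1)) μ :=
        (Lp.memLp ((2 : ℝ) • f)).abs.add (Lp.memLp h).abs
      have h1 := integral_rpow_mul_mul_le hp hA (Lp.memLp h) (Lp.memLp h)
      have h2 := (integrable_rpow_mul_mul hp hA (Lp.memLp h).abs (Lp.memLp h).abs).const_mul
        ((p + 1) * p)
      rw [hD, ← integral_const_mul, ← integral_sub, ← integral_sub]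
      · calc _ ≤ ∫ x, (p + 1) * p * (|(|((2 : ℝ) • f) x| + |h x|)| ^ (p - 1) * |h x| * |h x|) ∂μ := by
              refine norm_integral_le_of_norm_le h2 ?_
              filter_upwards [Lp.coeFn_add f h, Lp.coeFn_smul (2 : ℝ) f] with x hx hx'
              rw [hx, hx', Pi.add_apply, Pi.smul_apply, smul_eq_mul, abs_mul 2, abs_two,
                abs_of_nonneg (by positivity : 0 ≤ 2 * |f x| + |h x|), Real.norm_eq_abs]
              exact abs_rpow_add_sub_sub_le hp _ _
          _ ≤ (p + 1) * p * ((2 * ‖f‖ + ‖h‖) ^ (p - 1) * ‖h‖ * ‖h‖) := by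
              rw [integral_const_mul]
              have := hsum ((2 : ℝ) • f) h
              rw [norm_smul, Real.norm_two] at this
              refine mul_le_mul_of_nonneg_left (h1.trans ?_) (by nlinarith)
              rw [habs]
              have : (eLpNorm (fun x => |((2 : ℝ) • f) x| + |h x|)
                (ENNReal.ofReal (p + 1)) μ).toReal ^ (p - 1) ≤ (2 * ‖f‖ + ‖h‖) ^ (p - 1) :=
                Real.rpow_le_rpow ENNReal.toReal_nonneg this (by linarith)
              gcongr
          _ = _ := by ring
      · exact (MemLp.integrable_abs_rpow hp (Lp.memLp _)).sub
          (MemLp.integrable_abs_rpow hp (Lp.memLp _))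
      · exact (hint f h).const_mul _
      · exact MemLp.integrable_abs_rpow hp (Lp.memLp _)
      · exact MemLp.integrable_abs_rpow hp (Lp.memLp _)
    rw [hasFDerivAt_iff_tendsto]
    have hc : Filter.Tendsto (fun g => (p + 1) * p * (2 * ‖f‖ + ‖g - f‖) ^ (p - 1) * ‖g - f‖)
        (nhds f) (nhds 0) := by
      have : Continuous fun g : Lp ℝ (ENNReal.ofReal (p + 1)) μ =>
          (p + 1) * p * (2 * ‖f‖ + ‖g - f‖) ^ (p - 1) * ‖g - f‖ := by
        refine Continuous.mul (continuous_const.mul ?_) (by fun_prop)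
        exact Continuous.rpow_const (by fun_prop) fun _ => Or.inr (by linarith)
      simpa using this.tendsto f
    refine squeeze_zero (fun _ => by positivity) (fun g => ?_) hc
    have h := hrem (g - f)
    rw [add_sub_cancel] at h
    rcases (norm_nonneg (g - f)).eq_or_lt with h0 | h0
    · rw [← h0]; simp
    · rw [inv_mul_le_iff₀ h0, mul_comm ‖g - f‖]
      exact h

end Hoelder


/-! ### Sobolev bounds for `C¹` functions of compact support. -/

section Sobolev

open scoped NNReal ENNReal

/-- The Cauchy–Schwarz inequality for the lower Lebesgue integral. -/
theorem lintegral_mul_sq_le {α : Type*} [MeasurableSpace α] {μ : Measure α} {f g : α → ℝ≥0∞}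
    (hf : AEMeasurable f μ) (hg : AEMeasurable g μ) :
    (∫⁻ x, f x * g x ∂μ) ^ 2 ≤ (∫⁻ x, f x ^ 2 ∂μ) * ∫⁻ x, g x ^ 2 ∂μ := by
  have h := ENNReal.lintegral_mul_le_Lp_mul_Lq μ Real.HolderConjugate.two_two hf hg
  simp only [Pi.mul_apply, ENNReal.rpow_two] at h
  refine (pow_le_pow_left' h 2).trans (le_of_eq ?_)
  rw [mul_pow, ← ENNReal.rpow_two, ← ENNReal.rpow_two, ← ENNReal.rpow_mul, ← ENNReal.rpow_mul]
  norm_num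

/-- Split at `a = 1`. This replaces interpolation: an `L²` bound and one large exponent give all
exponents in between. -/
theorem ENNReal.rpow_le_sq_add_rpow (a : ℝ≥0∞) {q Q : ℝ} (hq : 2 ≤ q) (hQ : q ≤ Q) :
    a ^ q ≤ a ^ 2 + a ^ Q := by
  rcases le_total a 1 with h | h
  · refine le_add_right ?_
    rw [← ENNReal.rpow_two]
    exact ENNReal.rpow_le_rpow_of_exponent_ge h hq
  · exact le_add_left (ENNReal.rpow_le_rpow_of_exponent_le h hQ)

/-- A bound for `∫ |f| ^ q` over the `C¹` functions of compact support whose `H¹` norm is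
controlled by `M`. -/
def HasSobolevBound (N : ℕ) (q : ℝ) : Prop :=
  ∀ M : ℝ≥0, ∃ C : ℝ≥0, ∀ f : EuclideanSpace ℝ (Fin N) → ℝ, ContDiff ℝ 1 f →
    HasCompactSupport f → ∫⁻ x, ‖f x‖ₑ ^ 2 ≤ M → ∫⁻ x, ‖fderiv ℝ f x‖ₑ ^ 2 ≤ M →
      ∫⁻ x, ‖f x‖ₑ ^ q ≤ C

theorem HasSobolevBound.of_le {N : ℕ} {q Q : ℝ} (h : HasSobolevBound N Q) (hq : 2 ≤ q)
    (hQ : q ≤ Q) : HasSobolevBound N q := by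
  intro M
  obtain ⟨C, hC⟩ := h M
  refine ⟨M + C, fun f hf hfc h1 h2 => ?_⟩
  calc ∫⁻ x, ‖f x‖ₑ ^ q ≤ ∫⁻ x, (‖f x‖ₑ ^ 2 + ‖f x‖ₑ ^ Q) :=
        lintegral_mono fun x => ENNReal.rpow_le_sq_add_rpow _ hq hQ
    _ = (∫⁻ x, ‖f x‖ₑ ^ 2) + ∫⁻ x, ‖f x‖ₑ ^ Q :=
        lintegral_add_left (hf.continuous.measurable.enorm.pow_const 2) _
    _ ≤ M + C := add_le_add h1 (hC f hf hfc h1 h2)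
    _ = _ := by push_cast; rfl

/-- Write `f(x)²` as the integral of `2 f f'` over `(-∞, x]` and apply Cauchy–Schwarz. -/
theorem enorm_sq_le_of_contDiff_real {f : ℝ → ℝ} (hf : ContDiff ℝ 1 f)
    (hfc : HasCompactSupport f) {M : ℝ≥0} (h1 : ∫⁻ x, ‖f x‖ₑ ^ 2 ≤ M)
    (h2 : ∫⁻ x, ‖deriv f x‖ₑ ^ 2 ≤ M) (x : ℝ) : ‖f x‖ₑ ^ 2 ≤ 2 * M := by
  have hd : Continuous (deriv f) := hf.continuous_deriv le_rfl
  have hg : ContDiff ℝ 1 fun y => f y * f y := hf.mul hf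
  have hgc : HasCompactSupport fun y => f y * f y := hfc.mul_left
  have h := hgc.enorm_le_lintegral_Ici_deriv hg x
  have hder (y : ℝ) : ‖deriv (fun y => f y * f y) y‖ₑ = 2 * (‖f y‖ₑ * ‖deriv f y‖ₑ) := by
    have hy := (hf.differentiable one_ne_zero y).hasDerivAt
    have : deriv (fun y => f y * f y) y = 2 * (f y * deriv f y) := by
      refine (hy.mul hy).deriv.trans ?_
      ring
    rw [this, enorm_mul, enorm_mul, Real.enorm_eq_ofReal zero_le_two, ENNReal.ofReal_ofNat]
  have hcs := lintegral_mul_sq_le (μ := volume) (f := fun y => ‖f y‖ₑ)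
    (g := fun y => ‖deriv f y‖ₑ) hf.continuous.measurable.enorm.aemeasurable
    hd.measurable.enorm.aemeasurable
  have hle : ∫⁻ y, ‖f y‖ₑ * ‖deriv f y‖ₑ ≤ M := by
    refine (ENNReal.pow_le_pow_left_iff two_ne_zero).1 (hcs.trans ?_)
    rw [sq (M : ℝ≥0∞)]
    exact mul_le_mul' h1 h2
  calc ‖f x‖ₑ ^ 2 = ‖f x * f x‖ₑ := by rw [enorm_mul, sq]
    _ ≤ ∫⁻ y in Iic x, ‖deriv (fun y => f y * f y) y‖ₑ := h
    _ ≤ ∫⁻ y, ‖deriv (fun y => f y * f y) y‖ₑ := setLIntegral_le_lintegral _ _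
    _ = 2 * ∫⁻ y, ‖f y‖ₑ * ‖deriv f y‖ₑ := by
        simp only [hder]
        exact lintegral_const_mul _ (hf.continuous.measurable.enorm.mul hd.measurable.enorm)
    _ ≤ 2 * M := by gcongr

theorem enorm_sq_le_of_contDiff_one {f : EuclideanSpace ℝ (Fin 1) → ℝ} (hf : ContDiff ℝ 1 f)
    (hfc : HasCompactSupport f) {M : ℝ≥0} (h1 : ∫⁻ x, ‖f x‖ₑ ^ 2 ≤ M)
    (h2 : ∫⁻ x, ‖fderiv ℝ f x‖ₑ ^ 2 ≤ M) (x : EuclideanSpace ℝ (Fin 1)) :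
    ‖f x‖ₑ ^ 2 ≤ 2 * M := by
  let b := OrthonormalBasis.singleton (Fin 1) ℝ
  let e : ℝ ≃ₗᵢ[ℝ] EuclideanSpace ℝ (Fin 1) := b.repr
  have he : MeasurePreserving e volume volume := b.measurePreserving_repr
  have hem : MeasurableEmbedding e := e.toHomeomorph.measurableEmbedding
  have hder (t : ℝ) : ‖deriv (f ∘ e) t‖ₑ ≤ ‖fderiv ℝ f (e t)‖ₑ := by
    have h3 : HasDerivAt (f ∘ e) (fderiv ℝ f (e t) (e 1)) t :=
      ((hf.differentiable one_ne_zero (e t)).hasFDerivAt.comp_hasDerivAt t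
        (e.toContinuousLinearEquiv.toContinuousLinearMap.hasDerivAt))
    rw [h3.deriv, enorm_le_iff_norm_le]
    refine (ContinuousLinearMap.le_opNorm _ _).trans ?_
    simp
  have h := enorm_sq_le_of_contDiff_real (f := f ∘ e) (M := M)
    (hf.comp e.toContinuousLinearEquiv.contDiff)
    (hfc.comp_homeomorph e.toHomeomorph)
    ((he.lintegral_comp_emb hem fun y => ‖f y‖ₑ ^ 2).le.trans h1)
    ((lintegral_mono fun t => pow_le_pow_left' (hder t) 2).trans
      ((he.lintegral_comp_emb hem fun y => ‖fderiv ℝ f y‖ₑ ^ 2).le.trans h2)) (e.symm x)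
  simpa using h

/-- Bound `k` factors of `f²` by its supremum and integrate the remaining one. Even integers
suffice, since they are unbounded. -/
theorem hasSobolevBound_one (k : ℕ) : HasSobolevBound 1 (2 * (k + 1 : ℕ) : ℕ) := by
  intro M
  refine ⟨(2 * M) ^ k * M, fun f hf hfc h1 h2 => ?_⟩
  have h := enorm_sq_le_of_contDiff_one hf hfc h1 h2
  calc ∫⁻ x, ‖f x‖ₑ ^ (((2 * (k + 1 : ℕ) : ℕ)) : ℝ)
      ≤ ∫⁻ x, ((2 * M : ℝ≥0) : ℝ≥0∞) ^ k * ‖f x‖ₑ ^ 2 := by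
        refine lintegral_mono fun x => ?_
        rw [ENNReal.rpow_natCast, pow_mul, pow_succ]
        gcongr
        simpa using h x
    _ = ((2 * M : ℝ≥0) : ℝ≥0∞) ^ k * ∫⁻ x, ‖f x‖ₑ ^ 2 :=
        lintegral_const_mul _ (hf.continuous.measurable.enorm.pow_const 2)
    _ ≤ ((2 * M : ℝ≥0) : ℝ≥0∞) ^ k * M := by gcongr
    _ = _ := by push_cast; rfl

/-- Induction through the Gagliardo–Nirenberg–Sobolev inequality `W^{1,1} → L²` of the plane,
applied to `f ^ (k + 2)`. Its gradient is `(k + 2) f ^ (k + 1) ∇f`, so Cauchy–Schwarz leaves `∫ f ^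
(2 (k + 1))`, bounded by the induction hypothesis, times `∫ |∇f|²`. -/
theorem hasSobolevBound_two (k : ℕ) : HasSobolevBound 2 (2 * (k + 1 : ℕ) : ℕ) := by
  induction k with
  | zero =>
    intro M
    refine ⟨M, fun f hf hfc h1 h2 => ?_⟩
    simpa only [ENNReal.rpow_natCast] using h1
  | succ k ih =>
    intro M
    obtain ⟨C, hC⟩ := ih M
    let K : ℝ≥0 := lintegralPowLePowLIntegralFDerivConst
      (volume : Measure (EuclideanSpace ℝ (Fin 2))) 2
    refine ⟨K * ((k + 2 : ℕ) ^ 2 * (C * M)), fun f hf hfc h1 h2 => ?_⟩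
    have hfm : Measurable fun x => ‖f x‖ₑ := hf.continuous.measurable.enorm
    have hdm : Measurable fun x => ‖fderiv ℝ f x‖ₑ :=
      (hf.continuous_fderiv one_ne_zero).measurable.enorm
    have hconj : Real.HolderConjugate
        (Module.finrank ℝ (EuclideanSpace ℝ (Fin 2)) : ℝ) 2 := by
      simpa using Real.HolderConjugate.two_two
    have h := lintegral_pow_le_pow_lintegral_fderiv
      (volume : Measure (EuclideanSpace ℝ (Fin 2))) (u := f ^ (k + 2)) (hf.pow (k + 2))
      (hfc.comp_left (g := fun y : ℝ => y ^ (k + 2)) (by simp)) hconj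
    have hder (x) : ‖fderiv ℝ (f ^ (k + 2)) x‖ₑ
        = (k + 2 : ℕ) * (‖f x‖ₑ ^ (k + 1) * ‖fderiv ℝ f x‖ₑ) := by
      rw [fderiv_pow (k + 2) (hf.differentiable one_ne_zero x), nsmul_eq_mul, enorm_smul,
        enorm_mul, enorm_pow, mul_assoc, show k + 2 - 1 = k + 1 from rfl]
      congr 1
      rw [Real.enorm_eq_ofReal (by positivity), ENNReal.ofReal_natCast]
    have hcs := lintegral_mul_sq_le (μ := volume) (f := fun y => ‖f y‖ₑ ^ (k + 1))
      (g := fun y => ‖fderiv ℝ f y‖ₑ) (hfm.pow_const _).aemeasurable hdm.aemeasurable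
    have hCf := hC f hf hfc h1 h2
    simp only [ENNReal.rpow_natCast] at hCf ⊢
    simp only [ENNReal.rpow_two, hder] at h
    have hmul : ∫⁻ x, ((k + 2 : ℕ) : ℝ≥0∞) * (‖f x‖ₑ ^ (k + 1) * ‖fderiv ℝ f x‖ₑ) =
        (k + 2 : ℕ) * ∫⁻ x, ‖f x‖ₑ ^ (k + 1) * ‖fderiv ℝ f x‖ₑ :=
      lintegral_const_mul _ ((hfm.pow_const _).mul hdm)
    rw [hmul, mul_pow] at h
    calc ∫⁻ x, ‖f x‖ₑ ^ (2 * (k + 1 + 1))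
        = ∫⁻ x, ‖(f ^ (k + 2)) x‖ₑ ^ 2 := by
          refine lintegral_congr fun x => ?_
          rw [Pi.pow_apply, enorm_pow, ← pow_mul]
          ring_nf
      _ ≤ _ := h
      _ ≤ K * ((k + 2 : ℕ) ^ 2 * (C * M)) := by
          gcongr
          refine hcs.trans ?_
          gcongr
          refine le_trans (le_of_eq (lintegral_congr fun x => ?_)) hCf
          rw [← pow_mul]
          ring_nf
      _ = _ := by push_cast; rfl

/-- The exponent `Q = 2 N / (N - 2)` satisfies `1 / Q = 1 / 2 - 1 / N`, so the gradient bound alone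
controls the `L ^ Q` norm. -/
theorem hasSobolevBound_critical {N : ℕ} (hN : 3 ≤ N) :
    HasSobolevBound N (2 * N / (N - 2)) := by
  intro M
  have hN' : (3 : ℝ) ≤ N := by exact_mod_cast hN
  have hQ : 0 < 2 * (N : ℝ) / (N - 2) := div_pos (by linarith) (by linarith)
  let Q : ℝ≥0 := ⟨2 * N / (N - 2), hQ.le⟩
  have hQc : (Q : ℝ) = 2 * N / (N - 2) := rfl
  have hQ0 : Q ≠ 0 := by
    intro h
    rw [← NNReal.coe_inj, hQc] at h
    exact hQ.ne' h
  let K : ℝ≥0 := eLpNormLESNormFDerivOfEqInnerConst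
    (volume : Measure (EuclideanSpace ℝ (Fin N))) (2 : ℝ≥0)
  refine ⟨(K * M ^ (1 / 2 : ℝ)) ^ (Q : ℝ), fun f hf hfc h1 h2 => ?_⟩
  have h := eLpNorm_le_eLpNorm_fderiv_of_eq_inner
    (volume : Measure (EuclideanSpace ℝ (Fin N))) (p := 2) (p' := Q) hf hfc one_le_two
    (by simp; omega) (by
      rw [hQc]
      rw [finrank_euclideanSpace, Fintype.card_fin, NNReal.coe_inv,
        show ((2 : ℝ≥0) : ℝ) = 2 from rfl]
      have : (N : ℝ) - 2 ≠ 0 := by linarith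
      have h0 : (N : ℝ) ≠ 0 := by linarith
      field_simp)
  have h3 : eLpNorm (fderiv ℝ f) (2 : ℝ≥0) volume ≤ (M : ℝ≥0∞) ^ (1 / 2 : ℝ) := by
    rw [eLpNorm_nnreal_eq_lintegral two_ne_zero]
    simp only [NNReal.coe_ofNat, ENNReal.rpow_two]
    exact ENNReal.rpow_le_rpow h2 (by norm_num)
  rw [← hQc, ← eLpNorm_nnreal_pow_eq_lintegral hQ0, ENNReal.coe_rpow_of_nonneg _ Q.coe_nonneg,
    ENNReal.coe_mul, ENNReal.coe_rpow_of_nonneg _ (by norm_num)]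
  refine ENNReal.rpow_le_rpow (h.trans ?_) Q.coe_nonneg
  gcongr

/-- The Sobolev embedding of `H¹` into `L ^ q` for `2 ≤ q` and `(N - 2) q ≤ 2 N`, as an a priori
bound for `C¹` functions of compact support. -/
theorem hasSobolevBound {N : ℕ} (hN : 1 ≤ N) {q : ℝ} (hq : 2 ≤ q)
    (hqN : ((N : ℝ) - 2) * q ≤ 2 * N) : HasSobolevBound N q := by
  obtain ⟨k, hk⟩ := exists_nat_ge q
  have hk' : q ≤ ((2 * (k + 1 : ℕ) : ℕ) : ℝ) := by push_cast; linarith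
  rcases Nat.lt_or_ge N 3 with h | h
  · interval_cases N
    · exact (hasSobolevBound_one k).of_le hq hk'
    · exact (hasSobolevBound_two k).of_le hq hk'
  · refine (hasSobolevBound_critical h).of_le hq ?_
    have : (3 : ℝ) ≤ N := by exact_mod_cast h
    rw [le_div_iff₀ (by linarith)]
    linarith

end Sobolev


/-! ### Passage to `H¹` by mollification and cut-off. -/

section Mollification

open scoped NNReal ENNReal Convolution Topology
open ContinuousLinearMap Filter

theorem ENNReal.add_sq_le (a b : ℝ≥0∞) : (a + b) ^ 2 ≤ 4 * (a ^ 2 + b ^ 2) := by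
  rcases le_total a b with h | h
  · calc (a + b) ^ 2 ≤ (b + b) ^ 2 := by gcongr
      _ = 4 * b ^ 2 := by ring
      _ ≤ _ := by gcongr; exact le_add_self
  · calc (a + b) ^ 2 ≤ (a + a) ^ 2 := by gcongr
      _ = 4 * a ^ 2 := by ring
      _ ≤ _ := by gcongr; exact le_self_add

/-- Jensen's inequality for the square and a weight of total mass one. -/
theorem lintegral_mul_sq_le_of_lintegral_eq_one {α : Type*} [MeasurableSpace α] {μ : Measure α}
    {r h : α → ℝ≥0∞} (hr : AEMeasurable r μ) (hh : AEMeasurable h μ) (h1 : ∫⁻ x, r x ∂μ = 1) :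
    (∫⁻ x, r x * h x ∂μ) ^ 2 ≤ ∫⁻ x, r x * h x ^ 2 ∂μ := by
  -- Cauchy–Schwarz will be applied to `r h = r^{1/2} · (r^{1/2} h)`.
  have hs (x : α) : r x ^ (1 / 2 : ℝ) * r x ^ (1 / 2 : ℝ) = r x := by
    rw [← ENNReal.rpow_add_of_nonneg _ _ (by norm_num) (by norm_num)]
    norm_num
  have hrs : AEMeasurable (fun x => r x ^ (1 / 2 : ℝ)) μ := hr.pow_const _
  have := lintegral_mul_sq_le hrs (hrs.mul hh)
  simp only [Pi.mul_apply, ← mul_assoc, hs, mul_pow, sq (r _ ^ (1 / 2 : ℝ)), h1, one_mul] at this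
  exact this

/-- Mollification does not increase the `L²` norm. -/
theorem lintegral_enorm_normed_convolution_sq_le {E F : Type*} [NormedAddCommGroup E]
    [InnerProductSpace ℝ E] [FiniteDimensional ℝ E] [MeasurableSpace E] [BorelSpace E]
    [NormedAddCommGroup F] [NormedSpace ℝ F] (φ : ContDiffBump (0 : E)) {g : E → F}
    (hg : AEStronglyMeasurable g volume) :
    ∫⁻ x, ‖(φ.normed volume ⋆[lsmul ℝ ℝ, volume] g) x‖ₑ ^ 2 ≤ ∫⁻ x, ‖g x‖ₑ ^ 2 := by
  let r : E → ℝ≥0∞ := fun t => ‖φ.normed volume t‖ₑ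
  have hr : Measurable r := φ.continuous_normed.measurable.enorm
  have hr1 : ∫⁻ t, r t = 1 := by
    have h := φ.integral_normed (μ := (volume : Measure E))
    have h2 : ENNReal.ofReal (∫ t, φ.normed volume t) = ∫⁻ t, r t := by
      rw [ofReal_integral_eq_lintegral_ofReal φ.integrable_normed
        (Eventually.of_forall φ.nonneg_normed)]
      exact lintegral_congr fun t => (Real.enorm_eq_ofReal (φ.nonneg_normed t)).symm
    rw [← h2, h, ENNReal.ofReal_one]
  have hgx (x : E) : AEMeasurable (fun t => ‖g (x - t)‖ₑ) volume :=
    (hg.comp_quasiMeasurePreserving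
      (quasiMeasurePreserving_sub_left volume x)).enorm
  have hpt (x : E) : ‖(φ.normed volume ⋆[lsmul ℝ ℝ, volume] g) x‖ₑ ^ 2
      ≤ ∫⁻ t, r t * ‖g (x - t)‖ₑ ^ 2 := by
    refine le_trans (pow_le_pow_left' ?_ 2)
      (lintegral_mul_sq_le_of_lintegral_eq_one hr.aemeasurable (hgx x) hr1)
    refine (enorm_integral_le_lintegral_enorm _).trans (le_of_eq ?_)
    exact lintegral_congr fun t => by simp [r, enorm_smul]
  have hprod : AEMeasurable (Function.uncurry fun x t : E => r t * ‖g (x - t)‖ₑ ^ 2)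
      (volume.prod volume) := by
    have h := (hg.comp_quasiMeasurePreserving
      (quasiMeasurePreserving_sub_of_right_invariant
        (volume : Measure E) (volume : Measure E))).enorm
    exact (hr.comp measurable_snd).aemeasurable.mul (h.pow_const 2)
  calc ∫⁻ x, ‖(φ.normed volume ⋆[lsmul ℝ ℝ, volume] g) x‖ₑ ^ 2
      ≤ ∫⁻ x, ∫⁻ t, r t * ‖g (x - t)‖ₑ ^ 2 := lintegral_mono hpt
    -- Tonelli, after which translation invariance removes the shift by `t`.
    _ = ∫⁻ t, ∫⁻ x, r t * ‖g (x - t)‖ₑ ^ 2 := lintegral_lintegral_swap hprod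
    _ = ∫⁻ t, r t * ∫⁻ x, ‖g x‖ₑ ^ 2 := by
        refine lintegral_congr fun t => ?_
        rw [lintegral_const_mul' _ _ enorm_ne_top,
          lintegral_sub_right_eq_self (fun x => ‖g x‖ₑ ^ 2) t]
    _ = ∫⁻ x, ‖g x‖ₑ ^ 2 := by
        rw [lintegral_mul_const _ hr, hr1, one_mul]

variable {N : ℕ}

theorem contDiff_normed_convolution (φ : ContDiffBump (0 : EuclideanSpace ℝ (Fin N)))
    {u : EuclideanSpace ℝ (Fin N) → ℝ} (hu : LocallyIntegrable u volume) :
    ContDiff ℝ 1 (φ.normed volume ⋆[lsmul ℝ ℝ, volume] u) :=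
  φ.hasCompactSupport_normed.contDiff_convolution_left (n := 1) _ φ.contDiff_normed hu

/-- Mollification commutes with the weak gradient. -/
theorem IsWeakGradient.fderiv_normed_convolution {u : L2R N} {g : L2Vec N}
    (h : IsWeakGradient u g) (φ : ContDiffBump (0 : EuclideanSpace ℝ (Fin N)))
    (x : EuclideanSpace ℝ (Fin N)) :
    fderiv ℝ (φ.normed volume ⋆[lsmul ℝ ℝ, volume] (u : EuclideanSpace ℝ (Fin N) → ℝ)) x =
      innerSL ℝ ((φ.normed volume ⋆[lsmul ℝ ℝ, volume]
        (g : EuclideanSpace ℝ (Fin N) → EuclideanSpace ℝ (Fin N))) x) := by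
  set ρ := φ.normed (volume : Measure (EuclideanSpace ℝ (Fin N))) with hρ
  have hρs : ContDiff ℝ ((⊤ : ℕ∞) : WithTop ℕ∞) ρ := φ.contDiff_normed
  have hρ1 : ContDiff ℝ 1 ρ := φ.contDiff_normed
  have hρc : HasCompactSupport ρ := φ.hasCompactSupport_normed
  have hu : LocallyIntegrable (u : EuclideanSpace ℝ (Fin N) → ℝ) volume :=
    (Lp.memLp u).locallyIntegrable one_le_two
  have hg : LocallyIntegrable
      (g : EuclideanSpace ℝ (Fin N) → EuclideanSpace ℝ (Fin N)) volume :=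
    (Lp.memLp g).locallyIntegrable one_le_two
  have hd := (hρc.hasFDerivAt_convolution_left (lsmul ℝ ℝ) hρ1 hu x).fderiv
  rw [hd]
  refine ContinuousLinearMap.coe_injective
    ((EuclideanSpace.basisFun (Fin N) ℝ).toBasis.ext fun i => ?_)
  have e1 := (hρc.fderiv (𝕜 := ℝ)).convolutionExists_left
    (precompL (EuclideanSpace ℝ (Fin N)) (lsmul ℝ ℝ : ℝ →L[ℝ] ℝ →L[ℝ] ℝ))
    (hρ1.continuous_fderiv one_ne_zero) hu x
  have e2 := hρc.convolutionExists_left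
    (lsmul ℝ ℝ : ℝ →L[ℝ] EuclideanSpace ℝ (Fin N) →L[ℝ] EuclideanSpace ℝ (Fin N))
    hρ1.continuous hg x
  -- The reflected mollifier is the test function for the weak gradient; the sign from the
  -- reflection cancels the one from integration by parts.
  have hψ : IsTestFunction fun y => ρ (x - y) :=
    ⟨hρs.comp (contDiff_const.sub contDiff_id),
      hρc.comp_homeomorph (Homeomorph.subLeft x)⟩
  have hψd (y : EuclideanSpace ℝ (Fin N)) : fderiv ℝ (fun y => ρ (x - y)) y
      (EuclideanSpace.single i 1) = - fderiv ℝ ρ (x - y) (EuclideanSpace.single i 1) := by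
    have := ((hρ1.differentiable one_ne_zero (x - y)).hasFDerivAt.comp y
      ((hasFDerivAt_id y).const_sub x)).fderiv
    refine (congrArg (fun L => L (EuclideanSpace.single i 1)) this).trans ?_
    simp
  have hw := h _ hψ i
  simp only [hψd, mul_neg, integral_neg] at hw
  have hw' := neg_injective hw
  rw [OrthonormalBasis.coe_toBasis, EuclideanSpace.basisFun_apply]
  have l1 : (fderiv ℝ ρ ⋆[precompL (EuclideanSpace ℝ (Fin N)) (lsmul ℝ ℝ), volume]
      (u : EuclideanSpace ℝ (Fin N) → ℝ)) x (EuclideanSpace.single i 1)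
      = ∫ y, u y * fderiv ℝ ρ (x - y) (EuclideanSpace.single i 1) := by
    rw [convolution_def, ContinuousLinearMap.integral_apply e1,
      ← integral_sub_left_eq_self _ volume x]
    refine integral_congr_ae (Eventually.of_forall fun y => ?_)
    simp [precompL_apply, mul_comm]
  have l2 : inner ℝ ((ρ ⋆[lsmul ℝ ℝ, volume]
        (g : EuclideanSpace ℝ (Fin N) → EuclideanSpace ℝ (Fin N))) x)
        (EuclideanSpace.single i (1 : ℝ)) = ∫ y, g y i * ρ (x - y) := by
    have h3 := (EuclideanSpace.proj i : EuclideanSpace ℝ (Fin N) →L[ℝ] ℝ).integral_comp_comm e2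
    rw [EuclideanSpace.inner_single_right]
    simp only [one_mul, conj_trivial]
    refine Eq.trans ?_ (h3.symm.trans ?_)
    · rfl
    · rw [← integral_sub_left_eq_self _ volume x]
      refine integral_congr_ae (Eventually.of_forall fun y => ?_)
      simp [mul_comm]
  refine l1.trans (hw'.trans ?_)
  exact l2.symm

theorem IsWeakGradient.enorm_fderiv_normed_convolution {u : L2R N} {g : L2Vec N}
    (h : IsWeakGradient u g) (φ : ContDiffBump (0 : EuclideanSpace ℝ (Fin N)))
    (x : EuclideanSpace ℝ (Fin N)) :
    ‖fderiv ℝ (φ.normed volume ⋆[lsmul ℝ ℝ, volume]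
      (u : EuclideanSpace ℝ (Fin N) → ℝ)) x‖ₑ =
      ‖(φ.normed volume ⋆[lsmul ℝ ℝ, volume]
        (g : EuclideanSpace ℝ (Fin N) → EuclideanSpace ℝ (Fin N))) x‖ₑ := by
  rw [h.fderiv_normed_convolution φ x, ← ofReal_norm, innerSL_apply_norm, ofReal_norm]

/-- Cutting off at radius `R ≥ 1` increases the `H¹` norm at most by a constant factor. -/
theorem exists_cutoff_bound (N : ℕ) : ∃ (χ : ContDiffBump (0 : EuclideanSpace ℝ (Fin N)))
    (K : ℝ≥0), ∀ (R : ℝ), 1 ≤ R → ∀ f : EuclideanSpace ℝ (Fin N) → ℝ, ContDiff ℝ 1 f →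
      ∀ M : ℝ≥0, ∫⁻ x, ‖f x‖ₑ ^ 2 ≤ M → ∫⁻ x, ‖fderiv ℝ f x‖ₑ ^ 2 ≤ M →
      ContDiff ℝ 1 (fun x => χ (R⁻¹ • x) * f x) ∧
      HasCompactSupport (fun x => χ (R⁻¹ • x) * f x) ∧
      ∫⁻ x, ‖χ (R⁻¹ • x) * f x‖ₑ ^ 2 ≤ (K * M : ℝ≥0) ∧
      ∫⁻ x, ‖fderiv ℝ (fun x => χ (R⁻¹ • x) * f x) x‖ₑ ^ 2 ≤ (K * M : ℝ≥0) := by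
  let χ : ContDiffBump (0 : EuclideanSpace ℝ (Fin N)) := ⟨1, 2, one_pos, one_lt_two⟩
  have hχ : ContDiff ℝ 1 χ := χ.contDiff
  obtain ⟨K, hK⟩ := (χ.hasCompactSupport.fderiv (𝕜 := ℝ)).exists_bound_of_continuous
    (hχ.continuous_fderiv one_ne_zero)
  -- `K` bounds `|∇χ|`, hence also the gradient of the rescaled cut-off because `R⁻¹ ≤ 1`; the `4`
  -- comes from `ENNReal.add_sq_le`.
  refine ⟨χ, 4 * (1 + K.toNNReal ^ 2), fun R hR f hf M h1 h2 => ?_⟩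
  have hR0 : 0 < R := by linarith
  have hχR : ContDiff ℝ 1 fun x : EuclideanSpace ℝ (Fin N) => χ (R⁻¹ • x) :=
    hχ.comp (contDiff_const_smul _)
  have hχ1 (x : EuclideanSpace ℝ (Fin N)) : ‖χ (R⁻¹ • x)‖ₑ ≤ 1 := by
    rw [Real.enorm_eq_ofReal χ.nonneg]
    exact ENNReal.ofReal_le_one.2 χ.le_one
  have hd (x : EuclideanSpace ℝ (Fin N)) :
      ‖fderiv ℝ (fun x : EuclideanSpace ℝ (Fin N) => χ (R⁻¹ • x)) x‖ₑ ≤ (K.toNNReal : ℝ≥0∞) := by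
    have h3 := ((hχ.differentiable one_ne_zero (R⁻¹ • x)).hasFDerivAt.comp x
      ((hasFDerivAt_id x).const_smul R⁻¹)).fderiv
    refine (congrArg enorm h3).trans_le ?_
    rw [ContinuousLinearMap.comp_smul, ← ofReal_norm, norm_smul]
    refine ENNReal.ofReal_le_ofReal ?_
    rw [ContinuousLinearMap.comp_id, norm_inv, Real.norm_of_nonneg hR0.le]
    exact (mul_le_of_le_one_left (norm_nonneg _) (inv_le_one_of_one_le₀ hR)).trans (hK _)
  refine ⟨hχR.mul hf, ?_, ?_, ?_⟩
  · refine HasCompactSupport.mul_right ?_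
    exact χ.hasCompactSupport.comp_homeomorph (Homeomorph.smulOfNeZero R⁻¹ (inv_ne_zero hR0.ne'))
  · calc ∫⁻ x, ‖χ (R⁻¹ • x) * f x‖ₑ ^ 2 ≤ ∫⁻ x, ‖f x‖ₑ ^ 2 := by
          refine lintegral_mono fun x => pow_le_pow_left' ?_ 2
          rw [enorm_mul]
          exact mul_le_of_le_one_left' (hχ1 x)
      _ ≤ M := h1
      _ ≤ _ := by
          refine ENNReal.coe_le_coe.2 (le_mul_of_one_le_left' ?_)
          calc (1 : ℝ≥0) ≤ 4 * (1 + 0) := by norm_num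
            _ ≤ _ := by gcongr; exact zero_le
  · have hfm : Measurable fun x => ‖f x‖ₑ ^ 2 := hf.continuous.measurable.enorm.pow_const 2
    calc ∫⁻ x, ‖fderiv ℝ (fun x => χ (R⁻¹ • x) * f x) x‖ₑ ^ 2
        ≤ ∫⁻ x, 4 * (‖fderiv ℝ f x‖ₑ ^ 2 + (K.toNNReal : ℝ≥0∞) ^ 2 * ‖f x‖ₑ ^ 2) := by
          refine lintegral_mono fun x => ?_
          rw [fderiv_fun_mul (hχR.differentiable one_ne_zero x) (hf.differentiable one_ne_zero x),
            ← mul_pow]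
          refine le_trans (pow_le_pow_left' ?_ 2) (ENNReal.add_sq_le _ _)
          refine (enorm_add_le (E := EuclideanSpace ℝ (Fin N) →L[ℝ] ℝ) _ _).trans (add_le_add ?_ ?_)
          · rw [enorm_smul]
            exact mul_le_of_le_one_left' (hχ1 x)
          · rw [enorm_smul, mul_comm]
            exact mul_le_mul_left (hd x) _
      _ = 4 * ((∫⁻ x, ‖fderiv ℝ f x‖ₑ ^ 2) + (K.toNNReal : ℝ≥0∞) ^ 2 * ∫⁻ x, ‖f x‖ₑ ^ 2) := by
          rw [lintegral_const_mul' _ _ (by norm_num), lintegral_add_right _ (hfm.const_mul _),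
            lintegral_const_mul _ hfm]
      _ ≤ 4 * (M + (K.toNNReal : ℝ≥0∞) ^ 2 * M) := by gcongr
      _ = _ := by push_cast; ring

/-- The Sobolev bound extends from `C¹` functions of compact support to `H¹`. -/
theorem HasSobolevBound.lintegral_le_of_isWeakGradient {q : ℝ} (hS : HasSobolevBound N q)
    (M : ℝ≥0) : ∃ C : ℝ≥0, ∀ (u : L2R N) (g : L2Vec N), IsWeakGradient u g →
      ∫⁻ x, ‖u x‖ₑ ^ 2 ≤ M → ∫⁻ x, ‖g x‖ₑ ^ 2 ≤ M → ∫⁻ x, ‖u x‖ₑ ^ q ≤ C := by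
  obtain ⟨χ, K, hχ⟩ := exists_cutoff_bound N
  obtain ⟨C, hC⟩ := hS (K * M)
  refine ⟨C, fun u g hug h1 h2 => ?_⟩
  have hu : LocallyIntegrable (u : EuclideanSpace ℝ (Fin N) → ℝ) volume :=
    (Lp.memLp u).locallyIntegrable one_le_two
  -- The ratio of outer to inner radius stays equal to `2`, as required for almost everywhere
  -- convergence of the mollifications at Lebesgue points.
  let φ : ℕ → ContDiffBump (0 : EuclideanSpace ℝ (Fin N)) := fun n =>
    ⟨1 / (n + 1), 2 * (1 / (n + 1)), by positivity, by
      have : (0 : ℝ) < 1 / (n + 1) := by positivity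
      linarith⟩
  have hφ : Tendsto (fun n => (φ n).rOut) atTop (𝓝 0) := by
    simpa [φ] using (tendsto_one_div_add_atTop_nhds_zero_nat (𝕜 := ℝ)).const_mul 2
  let m : ℕ → EuclideanSpace ℝ (Fin N) → ℝ := fun n =>
    (φ n).normed volume ⋆[lsmul ℝ ℝ, volume] (u : EuclideanSpace ℝ (Fin N) → ℝ)
  let f : ℕ → EuclideanSpace ℝ (Fin N) → ℝ := fun n x => χ (((n : ℝ) + 1)⁻¹ • x) * m n x
  have hm (n : ℕ) : ContDiff ℝ 1 (m n) := contDiff_normed_convolution (φ n) hu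
  have hm1 (n : ℕ) : ∫⁻ x, ‖m n x‖ₑ ^ 2 ≤ M :=
    (lintegral_enorm_normed_convolution_sq_le (φ n) (Lp.memLp u).1).trans h1
  have hm2 (n : ℕ) : ∫⁻ x, ‖fderiv ℝ (m n) x‖ₑ ^ 2 ≤ M := by
    simp only [m, hug.enorm_fderiv_normed_convolution]
    exact (lintegral_enorm_normed_convolution_sq_le (φ n) (Lp.memLp g).1).trans h2
  have hf (n : ℕ) := hχ (n + 1) (by linarith [n.cast_nonneg (α := ℝ)]) (m n) (hm n) M
    (hm1 n) (hm2 n)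
  have hfC (n : ℕ) : ∫⁻ x, ‖f n x‖ₑ ^ q ≤ C :=
    hC _ (hf n).1 (hf n).2.1 (hf n).2.2.1 (hf n).2.2.2
  have hlim : ∀ᵐ x, Tendsto (fun n => f n x) atTop (𝓝 (u x)) := by
    filter_upwards [ContDiffBump.ae_convolution_tendsto_right_of_locallyIntegrable (φ := φ)
      (K := 2) hφ (Eventually.of_forall fun n => le_rfl) hu] with x hx
    have hc : Tendsto (fun n : ℕ => χ (((n : ℝ) + 1)⁻¹ • x)) atTop (𝓝 1) := by
      have h3 : Tendsto (fun n : ℕ => ((n : ℝ) + 1)⁻¹ • x) atTop (𝓝 0) := by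
        have := (tendsto_one_div_add_atTop_nhds_zero_nat (𝕜 := ℝ)).smul_const x
        simpa using this
      have h4 := (χ.continuous.tendsto 0).comp h3
      rwa [χ.one_of_mem_closedBall (Metric.mem_closedBall_self χ.rIn_pos.le)] at h4
    simpa using hc.mul hx
  -- Fatou's lemma: almost everywhere convergence and the uniform bound suffice.
  calc ∫⁻ x, ‖u x‖ₑ ^ q = ∫⁻ x, liminf (fun n => ‖f n x‖ₑ ^ q) atTop := by
        refine lintegral_congr_ae ?_
        filter_upwards [hlim] with x hx
        exact ((ENNReal.continuous_rpow_const.tendsto _).comp hx.enorm).liminf_eq.symm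
    _ ≤ liminf (fun n => ∫⁻ x, ‖f n x‖ₑ ^ q) atTop :=
        lintegral_liminf_le fun n => (hf n).1.continuous.measurable.enorm.pow_const q
    _ ≤ C := (liminf_le_liminf (Eventually.of_forall hfC)).trans (liminf_const _).le

theorem lintegral_enorm_sq_eq {α F : Type*} [MeasurableSpace α] {μ : Measure α}
    [NormedAddCommGroup F] (f : Lp F 2 μ) :
    ∫⁻ x, ‖f x‖ₑ ^ 2 ∂μ = ((‖f‖₊ ^ 2 : ℝ≥0) : ℝ≥0∞) := by
  have h := eLpNorm_nnreal_pow_eq_lintegral (f := f) (μ := μ) (p := 2) two_ne_zero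
  simp only [NNReal.coe_ofNat, ENNReal.rpow_two] at h
  rw [← h, ENNReal.coe_pow, ← enorm_eq_nnnorm, Lp.enorm_def]
  rfl

/-- The Sobolev embedding as a continuous linear map into `L ^ q`. -/
theorem HasSobolevBound.exists_clm {q : ℝ} (hS : HasSobolevBound N q) (hq : 1 ≤ q)
    [Fact (1 ≤ ENNReal.ofReal q)] {V : Type*} [NormedAddCommGroup V] [NormedSpace ℝ V]
    (P : V →ₗ[ℝ] H1 N) {c : ℝ} (hc : 0 < c) (h1 : ∀ w, ‖(P w : L2R N)‖ ≤ c * ‖w‖)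
    (h2 : ∀ w, ‖weakGrad (P w)‖ ≤ c * ‖w‖) :
    ∃ T : V →L[ℝ] Lp ℝ (ENNReal.ofReal q) (volume : Measure (EuclideanSpace ℝ (Fin N))),
      ∀ w, T w =ᵐ[volume] (P w : L2R N) := by
  have hq0 : 0 < q := by linarith
  have hne : ENNReal.ofReal q ≠ 0 := by simpa using hq0
  have hnorm (u : L2R N) : eLpNorm u (ENNReal.ofReal q) volume
      = (∫⁻ x, ‖u x‖ₑ ^ q) ^ (1 / q) := by
    rw [eLpNorm_eq_lintegral_rpow_enorm_toReal hne ENNReal.ofReal_ne_top,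
      ENNReal.toReal_ofReal hq0.le]
  have bound (M : ℝ≥0) : ∃ C : ℝ≥0, ∀ w, ‖(P w : L2R N)‖ ≤ M → ‖weakGrad (P w)‖ ≤ M →
      eLpNorm (P w : L2R N) (ENNReal.ofReal q) volume ≤ C := by
    obtain ⟨C, hC⟩ := hS.lintegral_le_of_isWeakGradient (M ^ 2)
    refine ⟨C ^ (1 / q), fun w hw1 hw2 => ?_⟩
    rw [hnorm, ENNReal.coe_rpow_of_nonneg _ (by positivity)]
    refine ENNReal.rpow_le_rpow (hC _ _ (weakGrad_spec (P w)) ?_ ?_) (by positivity)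
    · rw [lintegral_enorm_sq_eq]
      exact ENNReal.coe_le_coe.2 (pow_le_pow_left' (NNReal.coe_le_coe.1 hw1) 2)
    · rw [lintegral_enorm_sq_eq]
      exact ENNReal.coe_le_coe.2 (pow_le_pow_left' (NNReal.coe_le_coe.1 hw2) 2)
  have hmem (w : V) : MemLp (P w : L2R N) (ENNReal.ofReal q) volume := by
    obtain ⟨C, hC⟩ := bound (max ‖(P w : L2R N)‖₊ ‖weakGrad (P w)‖₊)
    exact ⟨(Lp.memLp _).1, (hC w (le_max_left _ _) (le_max_right _ _)).trans_lt
      ENNReal.coe_lt_top⟩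
  let T₀ : V →ₗ[ℝ] Lp ℝ (ENNReal.ofReal q) (volume : Measure (EuclideanSpace ℝ (Fin N))) :=
    { toFun := fun w => (hmem w).toLp _
      map_add' := by
        intro w z
        rw [← MemLp.toLp_add]
        refine MemLp.toLp_congr _ _ ?_
        rw [map_add, Submodule.coe_add]
        exact Lp.coeFn_add _ _
      map_smul' := by
        intro t w
        rw [RingHom.id_apply, ← MemLp.toLp_const_smul]
        refine MemLp.toLp_congr _ _ ?_
        rw [map_smul, Submodule.coe_smul]
        exact Lp.coeFn_smul _ _ }
  obtain ⟨C, hC⟩ := bound 1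
  -- The bound is not homogeneous in `M`. On the ball of radius `c⁻¹` both `L²` norms are at most
  -- `1`, and linearity turns this into an operator bound.
  have hT₀ : ∃ C, ∀ w, ‖T₀ w‖ ≤ C * ‖w‖ := by
    refine LinearMap.bound_of_ball_bound (inv_pos.2 hc) C T₀ fun w hw => ?_
    rw [mem_ball_zero_iff] at hw
    have hcw : c * ‖w‖ ≤ 1 := by
      have := mul_le_mul_of_nonneg_left hw.le hc.le
      rwa [mul_inv_cancel₀ hc.ne'] at this
    have := hC w ((h1 w).trans hcw) ((h2 w).trans hcw)
    change ‖(hmem w).toLp _‖ ≤ C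
    rw [Lp.norm_toLp]
    exact ENNReal.toReal_le_coe_of_le_coe this
  exact ⟨T₀.mkContinuousOfExistsBound hT₀, fun w => (hmem w).coeFn_toLp⟩

end Mollification


/-! ### Test functions as elements of `H¹`. -/

section TestFunctions

variable {N : ℕ}

theorem gradient_apply_eq_fderiv {φ : EuclideanSpace ℝ (Fin N) → ℝ}
    (x : EuclideanSpace ℝ (Fin N)) (i : Fin N) :
    gradient φ x i = fderiv ℝ φ x (EuclideanSpace.single i 1) := by
  have h : inner ℝ (gradient φ x) (EuclideanSpace.single i (1 : ℝ))
      = fderiv ℝ φ x (EuclideanSpace.single i 1) :=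
    InnerProductSpace.toDual_symm_apply
  rw [← h, EuclideanSpace.inner_single_right]
  simp

theorem IsTestFunction.memLp_gradient {φ : EuclideanSpace ℝ (Fin N) → ℝ}
    (h : IsTestFunction φ) : MemLp (gradient φ) 2 volume := by
  refine Continuous.memLp_of_hasCompactSupport ?_ ?_
  · exact (InnerProductSpace.toDual ℝ (EuclideanSpace ℝ (Fin N))).symm.continuous.comp
      (h.1.continuous_fderiv (by simp))
  · exact (h.2.fderiv (𝕜 := ℝ)).comp_left
      (g := (InnerProductSpace.toDual ℝ (EuclideanSpace ℝ (Fin N))).symm) (map_zero _)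

/-- A test function is in `H¹`, and its weak gradient is its gradient. -/
theorem IsTestFunction.exists_H1 {φ : EuclideanSpace ℝ (Fin N) → ℝ} (h : IsTestFunction φ) :
    ∃ a : H1 N, (a : L2R N) =ᵐ[volume] φ ∧ weakGrad a =ᵐ[volume] gradient φ := by
  have hw : IsWeakGradient (h.memLp.toLp φ) (h.memLp_gradient.toLp (gradient φ)) := by
    intro ψ hψ i
    have e1 : ∫ x, h.memLp.toLp φ x * fderiv ℝ ψ x (EuclideanSpace.single i 1)
        = ∫ x, φ x * fderiv ℝ ψ x (EuclideanSpace.single i 1) := by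
      refine integral_congr_ae ?_
      filter_upwards [h.memLp.coeFn_toLp] with x hx
      rw [hx]
    have e2 : ∫ x, h.memLp_gradient.toLp (gradient φ) x i * ψ x
        = ∫ x, fderiv ℝ φ x (EuclideanSpace.single i 1) * ψ x := by
      refine integral_congr_ae ?_
      filter_upwards [h.memLp_gradient.coeFn_toLp] with x hx
      rw [hx, gradient_apply_eq_fderiv]
    rw [e1, e2]
    exact integral_mul_fderiv_eq_neg_fderiv_mul_of_integrable
      ((h.memLp_fderiv _).integrable_mul hψ.memLp) (h.memLp.integrable_mul (hψ.memLp_fderiv _))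
      (h.memLp.integrable_mul hψ.memLp) (fun x _ => h.1.differentiable (by simp) x)
      (fun x _ => hψ.1.differentiable (by simp) x)
  refine ⟨⟨h.memLp.toLp φ, _, hw⟩, h.memLp.coeFn_toLp, ?_⟩
  rw [(weakGrad_spec ⟨h.memLp.toLp φ, _, hw⟩).unique hw]
  exact h.memLp_gradient.coeFn_toLp

end TestFunctions

/-! ### The energy on `H`: embeddings, integrability and derivative. -/

section Energy

open scoped ENNReal

variable {N : ℕ} {σ₁ σ₂ ω : ℝ} {hσ₁ : 0 < σ₁} {hσ₂ : 0 < σ₂} {hω : 0 < ω}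

/-- The first component as a linear map. -/
def PairSpace.uₗ : PairSpace N hσ₁ hσ₂ hω →ₗ[ℝ] H1 N where
  toFun := PairSpace.u
  map_add' _ _ := rfl
  map_smul' _ _ := rfl

/-- The second component as a linear map. -/
def PairSpace.vₗ : PairSpace N hσ₁ hσ₂ hω →ₗ[ℝ] H1 N where
  toFun := PairSpace.v
  map_add' _ _ := rfl
  map_smul' _ _ := rfl

theorem PairSpace.norm_sq_eq (w : PairSpace N hσ₁ hσ₂ hω) :
    ‖w‖ ^ 2 = σ₁ * ‖weakGrad w.u‖ ^ 2 + ω * ‖(w.u : L2R N)‖ ^ 2 + σ₂ * ‖weakGrad w.v‖ ^ 2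
      + ω * ‖(w.v : L2R N)‖ ^ 2 := by
  rw [← real_inner_self_eq_norm_sq, inner_eq_pairInner, pairInner_eq]
  simp only [real_inner_self_eq_norm_sq]

/-- Each of the four nonnegative terms of `‖w‖ ^ 2` is at most the sum. These are the bounds that
`HasSobolevBound.exists_clm` needs for either component. -/
theorem PairSpace.exists_bound : ∃ c : ℝ, 0 < c ∧ ∀ w : PairSpace N hσ₁ hσ₂ hω,
    (‖(w.u : L2R N)‖ ≤ c * ‖w‖ ∧ ‖weakGrad w.u‖ ≤ c * ‖w‖) ∧
    ‖(w.v : L2R N)‖ ≤ c * ‖w‖ ∧ ‖weakGrad w.v‖ ≤ c * ‖w‖ := by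
  have key {s a b : ℝ} (hs : 0 < s) (hb : 0 ≤ b) (h : s * a ^ 2 ≤ b ^ 2) :
      a ≤ (Real.sqrt s)⁻¹ * b := by
    refine (le_abs_self a).trans (abs_le_of_sq_le_sq ?_ (by positivity))
    rw [mul_pow, inv_pow, Real.sq_sqrt hs.le, inv_mul_eq_div, le_div_iff₀ hs]
    linarith
  refine ⟨(Real.sqrt ω)⁻¹ + (Real.sqrt σ₁)⁻¹ + (Real.sqrt σ₂)⁻¹, by positivity, fun w => ?_⟩
  have h := w.norm_sq_eq
  have a1 : 0 ≤ σ₁ * ‖weakGrad w.u‖ ^ 2 := by positivity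
  have a2 : 0 ≤ σ₂ * ‖weakGrad w.v‖ ^ 2 := by positivity
  have a3 : 0 ≤ ω * ‖(w.u : L2R N)‖ ^ 2 := by positivity
  have a4 : 0 ≤ ω * ‖(w.v : L2R N)‖ ^ 2 := by positivity
  have b1 : 0 ≤ (Real.sqrt ω)⁻¹ * ‖w‖ := by positivity
  have b2 : 0 ≤ (Real.sqrt σ₁)⁻¹ * ‖w‖ := by positivity
  have b3 : 0 ≤ (Real.sqrt σ₂)⁻¹ * ‖w‖ := by positivity
  have c1 := key (a := ‖weakGrad w.u‖) hσ₁ (norm_nonneg w) (by linarith)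
  have c2 := key (a := ‖weakGrad w.v‖) hσ₂ (norm_nonneg w) (by linarith)
  have c3 := key (a := ‖(w.u : L2R N)‖) hω (norm_nonneg w) (by linarith)
  have c4 := key (a := ‖(w.v : L2R N)‖) hω (norm_nonneg w) (by linarith)
  simp only [add_mul]
  refine ⟨⟨?_, ?_⟩, ?_, ?_⟩ <;> linarith

theorem integrable_pairInner (w z : PairSpace N hσ₁ hσ₂ hω) :
    Integrable (fun x => σ₁ * inner ℝ (weakGrad w.u x) (weakGrad z.u x)
      + ω * ((w.u : L2R N) x * (z.u : L2R N) x)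
      + σ₂ * inner ℝ (weakGrad w.v x) (weakGrad z.v x)
      + ω * ((w.v : L2R N) x * (z.v : L2R N) x)) := by
  have i1 := (L2.integrable_inner (𝕜 := ℝ) (weakGrad w.u) (weakGrad z.u)).const_mul σ₁
  have i3 := (L2.integrable_inner (𝕜 := ℝ) (weakGrad w.v) (weakGrad z.v)).const_mul σ₂
  have i2 := ((Lp.memLp (w.u : L2R N)).integrable_mul (Lp.memLp (z.u : L2R N))).const_mul ω
  have i4 := ((Lp.memLp (w.v : L2R N)).integrable_mul (Lp.memLp (z.v : L2R N))).const_mul ω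
  exact ((i1.add i2).add i3).add i4

theorem functionalL_integrand_eq (w : PairSpace N hσ₁ hσ₂ hω) (x : EuclideanSpace ℝ (Fin N)) :
    σ₁ * ‖weakGrad w.u x‖ ^ 2 + σ₂ * ‖weakGrad w.v x‖ ^ 2
      + ω * ((w.u : L2R N) x ^ 2 + (w.v : L2R N) x ^ 2) =
    σ₁ * inner ℝ (weakGrad w.u x) (weakGrad w.u x)
      + ω * ((w.u : L2R N) x * (w.u : L2R N) x)
      + σ₂ * inner ℝ (weakGrad w.v x) (weakGrad w.v x)
      + ω * ((w.v : L2R N) x * (w.v : L2R N) x) := by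
  simp only [real_inner_self_eq_norm_sq]
  ring

theorem functionalL_eq_norm_sq (w : PairSpace N hσ₁ hσ₂ hω) :
    functionalL σ₁ σ₂ ω w.u w.v = ‖w‖ ^ 2 := by
  rw [← real_inner_self_eq_norm_sq, inner_eq_pairInner]
  exact integral_congr_ae (Filter.Eventually.of_forall fun x => functionalL_integrand_eq w x)

/-- Since `1/4 + 1/4 = 1/2`, the product `u v` lies in `L²`. The form `ENNReal.ofReal 4` matches the
target of the embedding. -/
theorem holderTriple_ofReal_four : ENNReal.HolderTriple (ENNReal.ofReal 4) (ENNReal.ofReal 4) 2 where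
  inv_add_inv_eq_inv := by
    rw [ENNReal.ofReal_ofNat, ← two_mul, show (4 : ℝ≥0∞) = 2 * 2 by norm_num,
      ENNReal.mul_inv (by simp) (by simp), ← mul_assoc,
      ENNReal.mul_inv_cancel (by simp) (by simp), one_mul]

theorem HasSobolevBound.exists_clm_pair {q : ℝ} (hS : HasSobolevBound N q) (hq : 1 ≤ q)
    [Fact (1 ≤ ENNReal.ofReal q)] :
    ∃ T S : PairSpace N hσ₁ hσ₂ hω →L[ℝ]
        Lp ℝ (ENNReal.ofReal q) (volume : Measure (EuclideanSpace ℝ (Fin N))),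
      (∀ w, T w =ᵐ[volume] (w.u : L2R N)) ∧ ∀ w, S w =ᵐ[volume] (w.v : L2R N) := by
  obtain ⟨c, hc, hb⟩ := PairSpace.exists_bound (N := N) (hσ₁ := hσ₁) (hσ₂ := hσ₂) (hω := hω)
  obtain ⟨T, hT⟩ := hS.exists_clm hq (PairSpace.uₗ (hσ₁ := hσ₁) (hσ₂ := hσ₂) (hω := hω)) hc
    (fun w => (hb w).1.1) (fun w => (hb w).1.2)
  obtain ⟨S, hS⟩ := hS.exists_clm hq (PairSpace.vₗ (hσ₁ := hσ₁) (hσ₂ := hσ₂) (hω := hω)) hc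
    (fun w => (hb w).2.1) (fun w => (hb w).2.2)
  exact ⟨T, S, hT, hS⟩

theorem PairSpace.exists_test {φ ψ : EuclideanSpace ℝ (Fin N) → ℝ} (hφ : IsTestFunction φ)
    (hψ : IsTestFunction ψ) : ∃ z : PairSpace N hσ₁ hσ₂ hω,
      ((z.u : L2R N) =ᵐ[volume] φ ∧ weakGrad z.u =ᵐ[volume] gradient φ) ∧
      (z.v : L2R N) =ᵐ[volume] ψ ∧ weakGrad z.v =ᵐ[volume] gradient ψ := by
  obtain ⟨a, ha⟩ := hφ.exists_H1
  obtain ⟨b, hb⟩ := hψ.exists_H1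
  exact ⟨(show PairSpace N hσ₁ hσ₂ hω from (a, b)), ha, hb⟩

theorem integrable_abs_rpow_add {p : ℝ} (hp : 1 < p) (hS : HasSobolevBound N (p + 1))
    (w : PairSpace N hσ₁ hσ₂ hω) :
    Integrable (fun x => |(w.u : L2R N) x| ^ (p + 1)) ∧
      Integrable (fun x => |(w.v : L2R N) x| ^ (p + 1)) := by
  have : Fact (1 ≤ ENNReal.ofReal (p + 1)) := ⟨by simp; linarith⟩
  obtain ⟨T, S, hT, hS⟩ := hS.exists_clm_pair (hσ₁ := hσ₁) (hσ₂ := hσ₂) (hω := hω) (by linarith)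
  exact ⟨MemLp.integrable_abs_rpow hp ((memLp_congr_ae (hT w)).1 (Lp.memLp (T w))),
    MemLp.integrable_abs_rpow hp ((memLp_congr_ae (hS w)).1 (Lp.memLp (S w)))⟩

theorem integrable_sq_mul_sq (hS : HasSobolevBound N 4) (w : PairSpace N hσ₁ hσ₂ hω) :
    Integrable (fun x => |(w.u : L2R N) x| ^ 2 * |(w.v : L2R N) x| ^ 2) := by
  have : Fact (1 ≤ ENNReal.ofReal 4) := ⟨by simp⟩
  have := holderTriple_ofReal_four
  obtain ⟨T, S, hT, hS⟩ := hS.exists_clm_pair (hσ₁ := hσ₁) (hσ₂ := hσ₂) (hω := hω) (by norm_num)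
  have h : MemLp (fun x => (w.v : L2R N) x * (w.u : L2R N) x) 2 volume :=
    ((memLp_congr_ae (hT w)).1 (Lp.memLp (T w))).mul' ((memLp_congr_ae (hS w)).1 (Lp.memLp (S w)))
  refine h.integrable_sq.congr (Filter.Eventually.of_forall fun x => ?_)
  simp only [sq_abs]
  ring

theorem real_inner_eq_mul_real (a b : ℝ) : inner ℝ a b = a * b := by
  simp [mul_comm]

theorem integral_sub_add_sub_mul_add {α : Type*} [MeasurableSpace α] {μ : Measure α}
    {a b c d e : α → ℝ} (l : ℝ) (ha : Integrable a μ) (hb : Integrable b μ)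
    (hc : Integrable c μ) (hd : Integrable d μ) (he : Integrable e μ) :
    Integrable (fun x => a x - (b x + c x) - l * (d x + e x)) μ ∧
    ∫ x, (a x - (b x + c x) - l * (d x + e x)) ∂μ =
      ∫ x, a x ∂μ - (∫ x, b x ∂μ + ∫ x, c x ∂μ) - l * (∫ x, d x ∂μ + ∫ x, e x ∂μ) := by
  have hbc : Integrable (fun x => b x + c x) μ := hb.add hc
  have habc : Integrable (fun x => a x - (b x + c x)) μ := ha.sub hbc
  have hde : Integrable (fun x => l * (d x + e x)) μ := (hd.add he).const_mul l
  exact ⟨habc.sub hde, by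
    rw [integral_sub habc hde, integral_sub ha hbc, integral_add hb hc, integral_const_mul,
      integral_add hd he]⟩

section AbstractEnergy

variable {H X Y Z : Type*} [NormedAddCommGroup H] [InnerProductSpace ℝ H]
  [NormedAddCommGroup X] [NormedSpace ℝ X] [NormedAddCommGroup Y] [NormedSpace ℝ Y]
  [NormedAddCommGroup Z] [InnerProductSpace ℝ Z]

/-- The abstract shape of the energy: `Φ` stands for `∫ |f| ^ (p + 1)`, `B` for multiplication `L⁴ ×
L⁴ → L²`, and the linear maps for the embeddings. The calculus is thereby free of almost-everywhere
representatives. -/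
theorem contDiff_quadratic_sub_comp_sub_norm_bilinear_sq {Φ : X → ℝ} (hΦ : ContDiff ℝ 1 Φ)
    (T S : H →L[ℝ] X) (B : Y →L[ℝ] Y →L[ℝ] Z) (T' S' : H →L[ℝ] Y) (c l : ℝ) :
    ContDiff ℝ 1 fun w => 1 / 2 * ‖w‖ ^ 2 - c * (Φ (T w) + Φ (S w))
      - l / 2 * ‖B (T' w) (S' w)‖ ^ 2 := by
  have hB : ContDiff ℝ 1 fun w => B (T' w) (S' w) :=
    B.isBoundedBilinearMap.contDiff.comp (T'.contDiff.prodMk S'.contDiff)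
  exact ((contDiff_const.mul (contDiff_norm_sq ℝ)).sub (contDiff_const.mul
    ((hΦ.comp T.contDiff).add (hΦ.comp S.contDiff)))).sub (contDiff_const.mul (hB.norm_sq ℝ))

theorem fderiv_quadratic_sub_comp_sub_norm_bilinear_sq {Φ : X → ℝ} {D : X → X →L[ℝ] ℝ}
    (hD : ∀ f, HasFDerivAt Φ (D f) f) (T S : H →L[ℝ] X) (B : Y →L[ℝ] Y →L[ℝ] Z)
    (T' S' : H →L[ℝ] Y) (c l : ℝ) (w z : H) :
    fderiv ℝ (fun w => 1 / 2 * ‖w‖ ^ 2 - c * (Φ (T w) + Φ (S w))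
      - l / 2 * ‖B (T' w) (S' w)‖ ^ 2) w z =
    inner ℝ w z - c * (D (T w) (T z) + D (S w) (S z))
      - l * (inner ℝ (B (T' w) (S' w)) (B (T' w) (S' z))
        + inner ℝ (B (T' w) (S' w)) (B (T' z) (S' w))) := by
  have h1 := (hasStrictFDerivAt_norm_sq w).hasFDerivAt.const_mul (1 / 2)
  have h2 := (((hD (T w)).comp w T.hasFDerivAt).add ((hD (S w)).comp w S.hasFDerivAt)).const_mul c
  have h3 := ((B.hasFDerivAt_of_bilinear (T'.hasFDerivAt (x := w))
    (S'.hasFDerivAt (x := w))).norm_sq).const_mul (l / 2)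
  refine (congrArg (fun L => L z) ((h1.sub h2).sub h3).fderiv).trans ?_
  simp
  ring

end AbstractEnergy

/-- The energy is `C¹`, and its derivative is given by the weak formulation. -/
theorem energy_contDiff_and_fderiv {p lam : ℝ} (hp : 1 < p) (hS : HasSobolevBound N (p + 1))
    (hS4 : HasSobolevBound N 4) :
    ContDiff ℝ 1 (fun w : PairSpace N hσ₁ hσ₂ hω => energy p lam w) ∧
    ∀ w z : PairSpace N hσ₁ hσ₂ hω,
      Integrable (fun x => σ₁ * inner ℝ (weakGrad w.u x) (weakGrad z.u x)
        + ω * ((w.u : L2R N) x * (z.u : L2R N) x)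
        + σ₂ * inner ℝ (weakGrad w.v x) (weakGrad z.v x)
        + ω * ((w.v : L2R N) x * (z.v : L2R N) x)
        - nonlin p lam ((w.u : L2R N) x) ((w.v : L2R N) x) * (z.u : L2R N) x
        - nonlin p lam ((w.v : L2R N) x) ((w.u : L2R N) x) * (z.v : L2R N) x) ∧
      fderiv ℝ (fun w : PairSpace N hσ₁ hσ₂ hω => energy p lam w) w z =
      ∫ x, (σ₁ * inner ℝ (weakGrad w.u x) (weakGrad z.u x)
        + ω * ((w.u : L2R N) x * (z.u : L2R N) x)
        + σ₂ * inner ℝ (weakGrad w.v x) (weakGrad z.v x)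
        + ω * ((w.v : L2R N) x * (z.v : L2R N) x)
        - nonlin p lam ((w.u : L2R N) x) ((w.v : L2R N) x) * (z.u : L2R N) x
        - nonlin p lam ((w.v : L2R N) x) ((w.u : L2R N) x) * (z.v : L2R N) x) := by
  have : Fact (1 ≤ ENNReal.ofReal (p + 1)) := ⟨by simp; linarith⟩
  have : Fact (1 ≤ ENNReal.ofReal 4) := ⟨by simp⟩
  have := holderTriple_ofReal_four
  obtain ⟨Tu, Tv, hTu, hTv⟩ := hS.exists_clm_pair (hσ₁ := hσ₁) (hσ₂ := hσ₂) (hω := hω)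
    (by linarith)
  obtain ⟨Su, Sv, hSu, hSv⟩ := hS4.exists_clm_pair (hσ₁ := hσ₁) (hσ₂ := hσ₂) (hω := hω)
    (by norm_num)
  obtain ⟨D, hDc, hD, hDe⟩ := exists_hasFDerivAt_integral_abs_rpow
    (μ := (volume : Measure (EuclideanSpace ℝ (Fin N)))) hp
  let Φ : Lp ℝ (ENNReal.ofReal (p + 1)) (volume : Measure (EuclideanSpace ℝ (Fin N))) → ℝ :=
    fun g => ∫ x, |g x| ^ (p + 1)
  obtain ⟨B, hB⟩ : ∃ B : Lp ℝ (ENNReal.ofReal 4) (volume : Measure (EuclideanSpace ℝ (Fin N)))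
      →L[ℝ] Lp ℝ (ENNReal.ofReal 4) (volume : Measure (EuclideanSpace ℝ (Fin N)))
      →L[ℝ] Lp ℝ 2 (volume : Measure (EuclideanSpace ℝ (Fin N))),
      ∀ w z : PairSpace N hσ₁ hσ₂ hω,
        B (Su w) (Sv z) =ᵐ[volume] fun x => (w.u : L2R N) x * (z.v : L2R N) x := by
    refine ⟨(ContinuousLinearMap.mul ℝ ℝ).holderL volume (ENNReal.ofReal 4) (ENNReal.ofReal 4) 2,
      fun w z => ?_⟩
    filter_upwards [(ContinuousLinearMap.mul ℝ ℝ).coeFn_holder (r := 2) (Su w) (Sv z), hSu w,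
      hSv z] with x hx h1 h2
    rw [← h1, ← h2]
    exact hx
  have hE : (fun w : PairSpace N hσ₁ hσ₂ hω => energy p lam w) = fun w =>
      1 / 2 * ‖w‖ ^ 2 - 1 / (p + 1) * (Φ (Tu w) + Φ (Tv w))
        - lam / 2 * ‖B (Su w) (Sv w)‖ ^ 2 := by
    funext w
    have hM : functionalM p w.u w.v = Φ (Tu w) + Φ (Tv w) := by
      have h1 := integrable_abs_rpow_add hp hS w
      refine (integral_add h1.1 h1.2).trans (congrArg₂ (· + ·) ?_ ?_)
      · refine integral_congr_ae ?_
        filter_upwards [hTu w] with x hx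
        rw [hx]
      · refine integral_congr_ae ?_
        filter_upwards [hTv w] with x hx
        rw [hx]
    have hN : functionalN lam w.u w.v = lam * ‖B (Su w) (Sv w)‖ ^ 2 := by
      rw [← real_inner_self_eq_norm_sq, L2.inner_def, functionalN]
      congr 1
      refine integral_congr_ae ?_
      filter_upwards [hB w w] with x hx
      rw [hx, real_inner_self_eq_norm_sq, Real.norm_eq_abs, abs_mul, mul_pow]
    rw [energy, functionalL_eq_norm_sq, hM, hN]
    ring
  refine ⟨?_, fun w z => ?_⟩
  · rw [hE]
    exact contDiff_quadratic_sub_comp_sub_norm_bilinear_sq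
      (contDiff_one_iff_hasFDerivAt.2 ⟨D, hDc, hD⟩) Tu Tv B Su Sv _ lam
  · have hu := (memLp_congr_ae (hTu w)).1 (Lp.memLp (Tu w))
    have hv := (memLp_congr_ae (hTv w)).1 (Lp.memLp (Tv w))
    have hzu := (memLp_congr_ae (hTu z)).1 (Lp.memLp (Tu z))
    have hzv := (memLp_congr_ae (hTv z)).1 (Lp.memLp (Tv z))
    have i0 := integrable_pairInner w z
    have i1 := integrable_rpow_mul_mul hp hu hu hzu
    have i2 := integrable_rpow_mul_mul hp hv hv hzv
    -- The two terms from differentiating `B` in its second and first argument are the coupling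
    -- parts of `f(v,u) ψ` and `f(u,v) φ` respectively.
    have e3 : (fun x => inner ℝ (B (Su w) (Sv w) x) (B (Su w) (Sv z) x)) =ᵐ[volume]
        fun x => (w.u : L2R N) x * (w.v : L2R N) x * ((w.u : L2R N) x * (z.v : L2R N) x) := by
      filter_upwards [hB w w, hB w z] with x h1 h2
      rw [h1, h2, real_inner_eq_mul_real]
    have e4 : (fun x => inner ℝ (B (Su w) (Sv w) x) (B (Su z) (Sv w) x)) =ᵐ[volume]
        fun x => (w.u : L2R N) x * (w.v : L2R N) x * ((z.u : L2R N) x * (w.v : L2R N) x) := by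
      filter_upwards [hB w w, hB z w] with x h1 h2
      rw [h1, h2, real_inner_eq_mul_real]
    have i3 := (L2.integrable_inner (𝕜 := ℝ) (B (Su w) (Sv w)) (B (Su w) (Sv z))).congr e3
    have i4 := (L2.integrable_inner (𝕜 := ℝ) (B (Su w) (Sv w)) (B (Su z) (Sv w))).congr e4
    have hpt : (fun x => σ₁ * inner ℝ (weakGrad w.u x) (weakGrad z.u x)
        + ω * ((w.u : L2R N) x * (z.u : L2R N) x)
        + σ₂ * inner ℝ (weakGrad w.v x) (weakGrad z.v x)
        + ω * ((w.v : L2R N) x * (z.v : L2R N) x)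
        - nonlin p lam ((w.u : L2R N) x) ((w.v : L2R N) x) * (z.u : L2R N) x
        - nonlin p lam ((w.v : L2R N) x) ((w.u : L2R N) x) * (z.v : L2R N) x) =
        fun x => (σ₁ * inner ℝ (weakGrad w.u x) (weakGrad z.u x)
          + ω * ((w.u : L2R N) x * (z.u : L2R N) x)
          + σ₂ * inner ℝ (weakGrad w.v x) (weakGrad z.v x)
          + ω * ((w.v : L2R N) x * (z.v : L2R N) x))
        - (|(w.u : L2R N) x| ^ (p - 1) * (w.u : L2R N) x * (z.u : L2R N) x
          + |(w.v : L2R N) x| ^ (p - 1) * (w.v : L2R N) x * (z.v : L2R N) x)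
        - lam * ((w.u : L2R N) x * (w.v : L2R N) x * ((w.u : L2R N) x * (z.v : L2R N) x)
          + (w.u : L2R N) x * (w.v : L2R N) x * ((z.u : L2R N) x * (w.v : L2R N) x)) := by
      funext x
      simp only [nonlin, sq_abs]
      ring
    rw [hpt]
    obtain ⟨hint, heq⟩ := integral_sub_add_sub_mul_add lam i0 i1 i2 i3 i4
    refine ⟨hint, ?_⟩
    have hcomp : fderiv ℝ (fun w : PairSpace N hσ₁ hσ₂ hω => energy p lam w) w z
        = pairInner w z - 1 / (p + 1) * (D (Tu w) (Tu z) + D (Tv w) (Tv z))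
          - lam * (inner ℝ (B (Su w) (Sv w)) (B (Su w) (Sv z))
            + inner ℝ (B (Su w) (Sv w)) (B (Su z) (Sv w))) := by
      have h := fderiv_quadratic_sub_comp_sub_norm_bilinear_sq hD Tu Tv B Su Sv
        (1 / (p + 1)) lam w z
      exact (congrArg (fun F => fderiv ℝ F w z) hE).trans h
    have d1 : D (Tu w) (Tu z) = (p + 1) *
        ∫ x, |(w.u : L2R N) x| ^ (p - 1) * (w.u : L2R N) x * (z.u : L2R N) x := by
      rw [hDe]
      congr 1
      refine integral_congr_ae ?_
      filter_upwards [hTu w, hTu z] with x h1 h2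
      rw [h1, h2]
    have d2 : D (Tv w) (Tv z) = (p + 1) *
        ∫ x, |(w.v : L2R N) x| ^ (p - 1) * (w.v : L2R N) x * (z.v : L2R N) x := by
      rw [hDe]
      congr 1
      refine integral_congr_ae ?_
      filter_upwards [hTv w, hTv z] with x h1 h2
      rw [h1, h2]
    have d12 : 1 / (p + 1) * (D (Tu w) (Tu z) + D (Tv w) (Tv z)) =
        (∫ x, |(w.u : L2R N) x| ^ (p - 1) * (w.u : L2R N) x * (z.u : L2R N) x)
        + ∫ x, |(w.v : L2R N) x| ^ (p - 1) * (w.v : L2R N) x * (z.v : L2R N) x := by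
      rw [d1, d2, ← mul_add, ← mul_assoc, one_div, inv_mul_cancel₀ (by linarith), one_mul]
    have d3 := (L2.inner_def (𝕜 := ℝ) (B (Su w) (Sv w)) (B (Su w) (Sv z))).trans
      (integral_congr_ae e3)
    have d4 := (L2.inner_def (𝕜 := ℝ) (B (Su w) (Sv w)) (B (Su z) (Sv w))).trans
      (integral_congr_ae e4)
    refine hcomp.trans (Eq.trans ?_ heq.symm)
    exact congrArg₂ (· - ·) (congrArg₂ (· - ·) rfl d12)
      (congrArg (lam * ·) (congrArg₂ (· + ·) d3 d4))

/-- Critical points of the energy are weak solutions. -/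
theorem isWeakSolution_of_fderiv_energy_eq_zero {p lam : ℝ} (hp : 1 < p)
    (hS : HasSobolevBound N (p + 1)) (hS4 : HasSobolevBound N 4) (w : PairSpace N hσ₁ hσ₂ hω)
    (hw : fderiv ℝ (fun z : PairSpace N hσ₁ hσ₂ hω => energy p lam z) w = 0) :
    IsWeakSolution p lam σ₁ σ₂ ω w.u w.v := by
  intro φ ψ hφ hψ F
  obtain ⟨z, ⟨h1, h2⟩, h3, h4⟩ := PairSpace.exists_test (hσ₁ := hσ₁) (hσ₂ := hσ₂) (hω := hω)
    hφ hψ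
  obtain ⟨hi, he⟩ := (energy_contDiff_and_fderiv (lam := lam) hp hS hS4).2 w z
  have hF : (fun x => σ₁ * inner ℝ (weakGrad w.u x) (weakGrad z.u x)
        + ω * ((w.u : L2R N) x * (z.u : L2R N) x)
        + σ₂ * inner ℝ (weakGrad w.v x) (weakGrad z.v x)
        + ω * ((w.v : L2R N) x * (z.v : L2R N) x)
        - nonlin p lam ((w.u : L2R N) x) ((w.v : L2R N) x) * (z.u : L2R N) x
        - nonlin p lam ((w.v : L2R N) x) ((w.u : L2R N) x) * (z.v : L2R N) x)
        =ᵐ[volume] F := by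
    filter_upwards [h1, h2, h3, h4] with x h1 h2 h3 h4
    rw [h1, h2, h3, h4]
  refine ⟨hi.congr hF, ?_⟩
  rw [← integral_congr_ae hF, ← he, hw]
  rfl

/-! ### Unboundedness in both directions. -/

/-- The energy along the ray through `(φ, 0)`. -/
theorem exists_energy_smul_eq {p lam : ℝ} (hp : 1 < p) {φ : EuclideanSpace ℝ (Fin N) → ℝ}
    (hφ : IsTestFunction φ) : ∃ w : PairSpace N hσ₁ hσ₂ hω, ω * ∫ x, φ x ^ 2 ≤ ‖w‖ ^ 2 ∧
      ∀ t : ℝ, 0 < t → energy p lam (t • w) =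
        t ^ 2 * (1 / 2 * ‖w‖ ^ 2 - t ^ (p - 1) * (1 / (p + 1) * ∫ x, |φ x| ^ (p + 1))) := by
  have h0 : IsTestFunction (0 : EuclideanSpace ℝ (Fin N) → ℝ) :=
    ⟨contDiff_const, HasCompactSupport.zero⟩
  obtain ⟨w, ⟨h1, -⟩, h2, -⟩ := PairSpace.exists_test (hσ₁ := hσ₁) (hσ₂ := hσ₂) (hω := hω) hφ h0
  refine ⟨w, ?_, fun t ht => ?_⟩
  · rw [w.norm_sq_eq]
    have e : ∫ x, φ x ^ 2 = ‖(w.u : L2R N)‖ ^ 2 := by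
      rw [← real_inner_self_eq_norm_sq, L2.inner_def]
      refine integral_congr_ae ?_
      filter_upwards [h1] with x hx
      rw [hx, real_inner_self_eq_norm_sq, Real.norm_eq_abs, sq_abs]
    rw [e]
    have a1 : 0 ≤ σ₁ * ‖weakGrad w.u‖ ^ 2 := by positivity
    have a2 : 0 ≤ σ₂ * ‖weakGrad w.v‖ ^ 2 := by positivity
    have a4 : 0 ≤ ω * ‖(w.v : L2R N)‖ ^ 2 := by positivity
    linarith
  · have hu : ((t • w).u : L2R N) =ᵐ[volume] fun x => t * φ x := by
      filter_upwards [Lp.coeFn_smul t (w.u : L2R N), h1] with x hx hx'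
      change (t • (w.u : L2R N)) x = _
      rw [hx, Pi.smul_apply, hx', smul_eq_mul]
    have hv : ((t • w).v : L2R N) =ᵐ[volume] fun _ => 0 := by
      filter_upwards [Lp.coeFn_smul t (w.v : L2R N), h2] with x hx hx'
      change (t • (w.v : L2R N)) x = _
      rw [hx, Pi.smul_apply, hx', Pi.zero_apply, smul_zero]
    have hM : functionalM p (t • w).u (t • w).v = t ^ (p + 1) * ∫ x, |φ x| ^ (p + 1) := by
      rw [functionalM, ← integral_const_mul]
      refine integral_congr_ae ?_
      filter_upwards [hu, hv] with x h3 h4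
      rw [h3, h4, abs_zero, Real.zero_rpow (by linarith), add_zero, abs_mul, abs_of_pos ht,
        Real.mul_rpow ht.le (abs_nonneg _)]
    have hN : functionalN lam (t • w).u (t • w).v = 0 := by
      have e : ∫ x, |((t • w).u : L2R N) x| ^ 2 * |((t • w).v : L2R N) x| ^ 2 = 0 := by
        refine integral_eq_zero_of_ae ?_
        filter_upwards [hv] with x hx
        rw [hx]
        simp
      rw [functionalN, e, mul_zero]
    have ht2 : t ^ (p + 1) = t ^ 2 * t ^ (p - 1) := by
      rw [← Real.rpow_two, ← Real.rpow_add ht]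
      ring_nf
    rw [energy, functionalL_eq_norm_sq, hM, hN, ht2, norm_smul, Real.norm_of_nonneg ht.le]
    ring

theorem ContDiffBump.isTestFunction (χ : ContDiffBump (0 : EuclideanSpace ℝ (Fin N))) :
    IsTestFunction χ := ⟨χ.contDiff, χ.hasCompactSupport⟩

/-- Along a ray with nonzero first component the bracket tends to `-∞` because `p - 1 > 0`. -/
theorem not_bddBelow_range_energy {p lam : ℝ} (hp : 1 < p) :
    ¬ BddBelow (range (fun w : PairSpace N hσ₁ hσ₂ hω => energy p lam w)) := by
  let χ : ContDiffBump (0 : EuclideanSpace ℝ (Fin N)) := ⟨1, 2, one_pos, one_lt_two⟩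
  obtain ⟨w, -, hw⟩ := exists_energy_smul_eq (lam := lam) (hσ₁ := hσ₁) (hσ₂ := hσ₂) (hω := hω)
    hp χ.isTestFunction
  have hpos : 0 < ∫ x, |χ x| ^ (p + 1) := by
    refine Continuous.integral_pos_of_hasCompactSupport_nonneg_nonzero (x := 0) ?_ ?_ ?_ ?_
    · exact χ.continuous.abs.rpow_const fun _ => Or.inr (by linarith)
    · exact χ.hasCompactSupport.comp_left (g := fun y : ℝ => |y| ^ (p + 1))
        (by rw [abs_zero, Real.zero_rpow (by linarith)])
    · intro x
      positivity
    · rw [χ.one_of_mem_closedBall (Metric.mem_closedBall_self χ.rIn_pos.le)]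
      simp
  have hlim : Filter.Tendsto (fun t : ℝ => t ^ 2 * (1 / 2 * ‖w‖ ^ 2 -
      t ^ (p - 1) * (1 / (p + 1) * ∫ x, |χ x| ^ (p + 1)))) Filter.atTop Filter.atBot := by
    refine (Filter.tendsto_pow_atTop two_ne_zero).atTop_mul_atBot₀ ?_
    refine Filter.tendsto_atBot_add_const_left _ _ (Filter.tendsto_neg_atTop_atBot.comp ?_)
    refine (tendsto_rpow_atTop (by linarith)).atTop_mul_const ?_
    have : 0 < p + 1 := by linarith
    positivity
  rintro ⟨c, hc⟩
  obtain ⟨t, ht, ht0⟩ := ((hlim.eventually_lt_atBot c).and (Filter.eventually_gt_atTop 0)).exists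
  have := hc ⟨t • w, rfl⟩
  simp only [hw t ht0] at this
  linarith

/-- For a bump `0 ≤ χ ≤ 1` the power integral is at most `∫ χ²`. At a fixed small height `s` the
energy of `(s χ, 0)` is thus at least a constant times `∫ χ²`, the gradient term only helping, and
this grows with the radius of the plateau. -/
theorem not_bddAbove_range_energy (hN : 1 ≤ N) {p lam : ℝ} (hp : 1 < p) :
    ¬ BddAbove (range (fun w : PairSpace N hσ₁ hσ₂ hω => energy p lam w)) := by
  rintro ⟨c, hc⟩
  have hp1 : 0 < p + 1 := by linarith
  -- With `s ^ (p - 1) = ω (p + 1) / 4` the power term takes away at most half of `ω / 2 * ∫ χ²`,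
  -- leaving `ω / 4`.
  let s : ℝ := (ω * (p + 1) / 4) ^ (p - 1)⁻¹
  have hs : 0 < s := by positivity
  have hsp : s ^ (p - 1) = ω * (p + 1) / 4 :=
    Real.rpow_inv_rpow (by positivity) (by linarith)
  let κ : ℝ := (volume : Measure (EuclideanSpace ℝ (Fin N))).real (Metric.ball 0 1)
  have hκ : 0 < κ := by
    refine ENNReal.toReal_pos (Metric.measure_ball_pos _ _ one_pos).ne' measure_ball_lt_top.ne
  have key (R : ℝ) (hR : 1 ≤ R) : s ^ 2 * (ω / 4) * κ * R ≤ c := by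
    let χ : ContDiffBump (0 : EuclideanSpace ℝ (Fin N)) :=
      ⟨R, R + 1, by linarith, by linarith⟩
    obtain ⟨w, hw2, hw⟩ := exists_energy_smul_eq (lam := lam) (hσ₁ := hσ₁) (hσ₂ := hσ₂)
      (hω := hω) hp χ.isTestFunction
    have hi2 : Integrable fun x => χ x ^ 2 := χ.isTestFunction.memLp.integrable_sq
    have hle : ∫ x, |χ x| ^ (p + 1) ≤ ∫ x, χ x ^ 2 := by
      refine integral_mono_of_nonneg (Filter.Eventually.of_forall fun x => by positivity) hi2
        (Filter.Eventually.of_forall fun x => ?_)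
      change |χ x| ^ (p + 1) ≤ χ x ^ 2
      rw [abs_of_nonneg χ.nonneg, ← Real.rpow_two]
      rcases (χ.nonneg (x := x)).eq_or_lt with h | h
      · rw [← h, Real.zero_rpow (by linarith), Real.zero_rpow two_ne_zero]
      · exact Real.rpow_le_rpow_of_exponent_ge h χ.le_one (by linarith)
    have hball : κ * R ≤ ∫ x, χ x ^ 2 := by
      calc κ * R ≤ R ^ N * κ := by
            rw [mul_comm]
            gcongr
            exact le_self_pow₀ hR (by omega)
        _ = (volume : Measure (EuclideanSpace ℝ (Fin N))).real (Metric.closedBall 0 R) := by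
            rw [Measure.addHaar_real_closedBall _ _ (by linarith), finrank_euclideanSpace,
              Fintype.card_fin]
        _ = ∫ x in Metric.closedBall (0 : EuclideanSpace ℝ (Fin N)) R, χ x ^ 2 := by
            rw [← setIntegral_one_eq_measureReal]
            refine setIntegral_congr_fun measurableSet_closedBall fun x hx => ?_
            simp [χ.one_of_mem_closedBall hx]
        _ ≤ ∫ x, χ x ^ 2 :=
            setIntegral_le_integral hi2 (Filter.Eventually.of_forall fun x => sq_nonneg _)
    have h := hc ⟨s • w, rfl⟩
    simp only [hw s hs, hsp] at h
    have h3 : ω * (p + 1) / 4 * (1 / (p + 1) * ∫ x, |χ x| ^ (p + 1))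
        = ω / 4 * ∫ x, |χ x| ^ (p + 1) := by field_simp
    rw [h3] at h
    refine le_trans ?_ h
    rw [mul_assoc, mul_assoc]
    refine mul_le_mul_of_nonneg_left ?_ (by positivity)
    have h4 : ω / 4 * ∫ x, |χ x| ^ (p + 1) ≤ ω / 4 * ∫ x, χ x ^ 2 := by gcongr
    have h5 : ω / 4 * (κ * R) ≤ ω / 4 * ∫ x, χ x ^ 2 := by gcongr
    linarith
  have hA : 0 < s ^ 2 * (ω / 4) * κ := by positivity
  -- This radius makes the lower bound at least `|c| + 1`, which exceeds `c`.
  have h1 := key (max 1 ((|c| + 1) / (s ^ 2 * (ω / 4) * κ))) (le_max_left _ _)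
  have h2 := mul_le_mul_of_nonneg_left
    (le_max_right 1 ((|c| + 1) / (s ^ 2 * (ω / 4) * κ))) hA.le
  rw [mul_div_cancel₀ _ hA.ne'] at h2
  linarith [le_abs_self c]

end Energy

end

theorem mainTheorem4 (N : ℕ) (hN : 1 ≤ N) (hN4 : N ≤ 4) (p lam σ₁ σ₂ ω : ℝ)
    (hp : 1 < p) (hpN : ((N : ℝ) - 2) * (p + 1) ≤ 2 * N) (hlam : 0 < lam)
    (hσ₁ : 0 < σ₁) (hσ₂ : 0 < σ₂) (hω : 0 < ω) :
    (∀ w : PairSpace N hσ₁ hσ₂ hω,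
      Integrable (fun x => σ₁ * ‖weakGrad w.u x‖ ^ 2 + σ₂ * ‖weakGrad w.v x‖ ^ 2
        + ω * ((w.u : L2R N) x ^ 2 + (w.v : L2R N) x ^ 2)) ∧
      Integrable (fun x => |(w.u : L2R N) x| ^ (p + 1) + |(w.v : L2R N) x| ^ (p + 1)) ∧
      Integrable (fun x => |(w.u : L2R N) x| ^ 2 * |(w.v : L2R N) x| ^ 2)) ∧
    ContDiff ℝ 1 (fun w : PairSpace N hσ₁ hσ₂ hω => energy p lam w) ∧
    (∀ w : PairSpace N hσ₁ hσ₂ hω,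
      fderiv ℝ (fun z : PairSpace N hσ₁ hσ₂ hω => energy p lam z) w = 0 →
        IsWeakSolution p lam σ₁ σ₂ ω w.u w.v) ∧
    ¬ BddAbove (range (fun w : PairSpace N hσ₁ hσ₂ hω => energy p lam w)) ∧
    ¬ BddBelow (range (fun w : PairSpace N hσ₁ hσ₂ hω => energy p lam w)) := by
  have hS : HasSobolevBound N (p + 1) := hasSobolevBound hN (by linarith) hpN
  -- For `q = 4` the Sobolev condition `(N - 2) q ≤ 2 N` says exactly `N ≤ 4`.
  have hS4 : HasSobolevBound N 4 := by
    have : (N : ℝ) ≤ 4 := by exact_mod_cast hN4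
    exact hasSobolevBound hN (by norm_num) (by linarith)
  refine ⟨fun w => ⟨?_, ?_, integrable_sq_mul_sq hS4 w⟩, (energy_contDiff_and_fderiv hp hS hS4).1,
    isWeakSolution_of_fderiv_energy_eq_zero hp hS hS4, not_bddAbove_range_energy hN hp,
    not_bddBelow_range_energy hp⟩
  · simp only [functionalL_integrand_eq]
    exact integrable_pairInner w w
  · exact (integrable_abs_rpow_add hp hS w).1.add (integrable_abs_rpow_add hp hS w).2
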